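/- Let $\ell$ be a prime and let $G$ be a finite group with a normal $\ell$-Sylow subgroup $N$ and a complement $H$, so $G = N\rtimes H$ with $(|H|,\ell)=1$. Let $t$ be the rank (minimal number of generators) of $N$, let ${\rm fr}(N)$ be the subgroup of $N$ generated by $\ell$-th powers and commutators, and identify $N/{\rm fr}(N)$ with $(\mathbb Z/\ell)^t$, so that there is a canonical surjection $\pi: G\to (\mathbb Z/\ell)^t\rtimes H$ that is the identity on $H$. A continuous surjection $\psi:E\to G$ from a profinite group is an $\ell$-Frattini cover if its kernel is pro-$\ell$ and no proper closed subgroup of $E$ maps onto $G$; it is the universal $\ell$-Frattini cover of $G$ if moreover it factors through every $\ell$-Frattini cover of $G$ (that is, for every $\ell$-Frattini cover $\chi:F\to G$ there is a continuous homomorphism $\theta:E\to F$ with $\chi\circ\theta=\psi$). The universal $\ell$-Frattini cover $\psi:{}_\ell\tilde G\to G$ exists. Write $\ker_0=\ker\psi$, let ${}_\ell M_G$ be the $\mathbb Z/\ell[G]$-module obtained from $\ker_0$ by dividing out the closed subgroup generated by $\ell$-th powers and commutators of elements of $\ker_0$, and let ${}_\ell\tilde\psi_{\rm ab}:{}_\ell\tilde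 G_{\rm ab}={}_\ell\tilde G/\overline{[\ker_0,\ker_0]}\to G$ be the abelianized cover. Then: (1) There is an action of $H$ on $(\mathbb Z/\ell^2)^t$ that lifts the action on $(\mathbb Z/\ell)^t$, such that the reduction map $\mu:(\mathbb Z/\ell^2)^t\rtimes H\to(\mathbb Z/\ell)^t\rtimes H$ is a Frattini cover (no proper subgroup maps onto the target) and $\mu'=\pi\circ\psi$ factors as $\mu\circ\theta$ with a continuous surjection $\theta:{}_\ell\tilde G\to(\mathbb Z/\ell^2)^t\rtimes H$. (2) Let $M'=\ker(\mu)\cong(\mathbb Z/\ell)^t$, a $\mathbb Z/\ell[G]$-module on which $G$ acts by conjugation through $\pi$. There is a surjective homomorphism $f:{}_\ell M_G\to M'$ of $\mathbb Z/\ell[G]$-modules. (3) There is a lattice quotient of ${}_\ell\tilde\psi_{\rm ab}$ with kernel $\mathbb Z_\ell^t$ that belongs to $M'$: an $\ell$-Frattini cover $\psi^\star:G^\star\to G$ whose kernel $L$ is isomorphic to $\mathbb Z_\ell^t$ as a topological group, and a continuous surjection $\nu:{}_\ell\tilde G_{\rm ab}\to G^\star$ with $\psi^\star\circ\nu={}_\ell\tilde\psi_{\rm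 ab}$, such that $\ell^kL/\ell^{k+1}L\cong M'$ as $\mathbb Z/\ell[G]$-modules for all $k\ge0$ and, for a suitable choice of this isomorphism for $k=0$, the map ${}_\ell M_G\to L/\ell L\cong M'$ induced by $\nu$ is $f$. -/

import Mathlib

universe u v

namespace LFrattini

open scoped commutatorElement

theorem normal_closure_of_conj_mem {A : Type u} [Group A] {S : Set A}
    (hS : ∀ g : A, ∀ x ∈ S, g * x * g⁻¹ ∈ S) : (Subgroup.closure S).Normal where
  conj_mem x hx g := by
    induction hx using Subgroup.closure_induction with
    | mem x hx => exact Subgroup.subset_closure (hS g x hx)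
    | one => simp
    | mul x y _ _ hx hy => simpa [mul_assoc] using mul_mem hx hy
    | inv x _ hx => simpa [mul_assoc] using inv_mem hx

/-! ### Elementary abelian sections of a group as modules -/

section Sections

variable {A : Type u} {B : Type v} [Group A] [Group B]

/-- The quotient `K / D` of two normal subgroups of `A` is an abelian group killed by `ℓ`
on which the kernel of the surjection `p : A → B` acts trivially by conjugation. So `K / D`
is a `ℤ/ℓ[B]`-module, `b = p a` acting as conjugation by `a`. -/
structure IsElemSection (ℓ : ℕ) (p : A →* B) (K D : Subgroup A) : Prop where
  surj : Function.Surjective p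
  K_normal : K.Normal
  D_normal : D.Normal
  pow_mem : ∀ x ∈ K, x ^ ℓ ∈ D
  comm_mem : ∀ x ∈ K, ∀ y ∈ K, ⁅x, y⁆ ∈ D
  triv_mem : ∀ a ∈ p.ker, ∀ x ∈ K, ⁅a, x⁆ ∈ D

variable {ℓ : ℕ} {p : A →* B} {K D : Subgroup A}

theorem IsElemSection.normal_subgroupOf (h : IsElemSection ℓ p K D) :
    (D.subgroupOf K).Normal := by
  have := h.D_normal
  infer_instance

/-- The section `K / D`, written additively. -/
def SectionModule (_h : IsElemSection ℓ p K D) : Type u :=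
  Additive (K ⧸ D.subgroupOf K)

/-- The class in `K / D` of an element of `K`. -/
def SectionModule.mk (h : IsElemSection ℓ p K D) (x : K) : SectionModule h :=
  Additive.ofMul (QuotientGroup.mk x : K ⧸ D.subgroupOf K)

instance (h : IsElemSection ℓ p K D) : AddCommGroup (SectionModule h) :=
  haveI := h.normal_subgroupOf
  { (inferInstance : AddGroup (Additive (K ⧸ D.subgroupOf K))) with
    add_comm := by
      intro x y
      induction x using QuotientGroup.induction_on with | H x => ?_
      induction y using QuotientGroup.induction_on with | H y => ?_
      refine (QuotientGroup.eq (s := D.subgroupOf K)).2 ?_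
      have := h.comm_mem _ (K.inv_mem y.2) _ (K.inv_mem x.2)
      rw [Subgroup.mem_subgroupOf]
      simpa [commutatorElement_def, mul_assoc] using this }

theorem SectionModule.nsmul_eq_zero (h : IsElemSection ℓ p K D) (x : SectionModule h) :
    ℓ • x = 0 := by
  have := h.normal_subgroupOf
  induction x using QuotientGroup.induction_on with | H x => ?_
  refine (QuotientGroup.eq_one_iff (N := D.subgroupOf K) (x ^ ℓ)).2 ?_
  rw [Subgroup.mem_subgroupOf]
  simpa using h.pow_mem _ x.2

instance (h : IsElemSection ℓ p K D) : Module (ZMod ℓ) (SectionModule h) :=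
  AddCommGroup.zmodModule (SectionModule.nsmul_eq_zero h)

/-- Conjugation by `a : A` on `K / D`. -/
def sectionConj (h : IsElemSection ℓ p K D) (a : A) : SectionModule h →+ SectionModule h :=
  haveI := h.normal_subgroupOf
  haveI := h.K_normal
  MonoidHom.toAdditive
    (QuotientGroup.map (D.subgroupOf K) (D.subgroupOf K) (MulAut.conjNormal a).toMonoidHom (by
      intro x hx
      rw [Subgroup.mem_subgroupOf] at hx
      simpa [Subgroup.mem_comap, Subgroup.mem_subgroupOf] using h.D_normal.conj_mem _ hx a))

theorem sectionConj_mk (h : IsElemSection ℓ p K D) (a : A) (x : K) :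
    sectionConj h a (SectionModule.mk h x) =
      SectionModule.mk h ⟨a * x * a⁻¹, h.K_normal.conj_mem _ x.2 a⟩ := by
  have := h.normal_subgroupOf
  have := h.K_normal
  refine congrArg (fun z : K => SectionModule.mk h z) ?_
  ext
  simp

theorem SectionModule.exists_mk (h : IsElemSection ℓ p K D) (x : SectionModule h) :
    ∃ y, SectionModule.mk h y = x := by
  induction x using QuotientGroup.induction_on with | H x => exact ⟨x, rfl⟩

/-- Conjugation, as a representation of `A` on `K / D`. -/
def sectionConjHom (h : IsElemSection ℓ p K D) :
    Representation (ZMod ℓ) A (SectionModule h) where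
  toFun a := (sectionConj h a).toZModLinearMap ℓ
  map_one' := by
    ext x
    obtain ⟨y, rfl⟩ := SectionModule.exists_mk h x
    simp [sectionConj_mk]
  map_mul' a b := by
    ext x
    obtain ⟨y, rfl⟩ := SectionModule.exists_mk h x
    simp [sectionConj_mk, mul_assoc]

theorem sectionConjHom_eq (h : IsElemSection ℓ p K D) {a b : A} (hab : p a = p b) :
    sectionConjHom h a = sectionConjHom h b := by
  have := h.normal_subgroupOf
  ext x
  obtain ⟨y, rfl⟩ := SectionModule.exists_mk h x
  change sectionConj h a _ = sectionConj h b _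
  rw [sectionConj_mk, sectionConj_mk]
  refine (QuotientGroup.eq (s := D.subgroupOf K)).2 ?_
  rw [Subgroup.mem_subgroupOf]
  have hk : b⁻¹ * a ∈ p.ker := by simp [MonoidHom.mem_ker, hab]
  simpa [commutatorElement_def, mul_assoc] using
    h.D_normal.conj_mem _ (h.triv_mem _ hk _ (K.inv_mem y.2)) b

/-- The `ℤ/ℓ[B]`-module `K / D`: `b` acts as conjugation by any preimage of `b` in `A`. -/
noncomputable def sectionRep (h : IsElemSection ℓ p K D) :
    Representation (ZMod ℓ) B (SectionModule h) where
  toFun b := sectionConjHom h (Function.surjInv h.surj b)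
  map_one' := by
    rw [← map_one (sectionConjHom h)]
    exact sectionConjHom_eq h (by simp [Function.surjInv_eq])
  map_mul' b c := by
    rw [← map_mul (sectionConjHom h)]
    exact sectionConjHom_eq h (by simp [Function.surjInv_eq])

theorem sectionRep_mk (h : IsElemSection ℓ p K D) (a : A) (x : K) :
    sectionRep h (p a) (SectionModule.mk h x) =
      SectionModule.mk h ⟨a * x * a⁻¹, h.K_normal.conj_mem _ x.2 a⟩ := by
  rw [← sectionConj_mk]
  exact LinearMap.congr_fun
    (sectionConjHom_eq h (Function.surjInv_eq h.surj (p a))) (SectionModule.mk h x)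

end Sections

/-! ### Frattini covers -/

/-- Frattini covers of abstract (in particular, finite) groups. -/
structure IsFrattiniCover {A : Type u} {B : Type v} [Group A] [Group B] (p : A →* B) : Prop where
  surjective : Function.Surjective p
  eq_top : ∀ K : Subgroup A, K.map p = ⊤ → K = ⊤

/-- A (compact) topological group is pro-`ℓ` if all its quotients by open normal subgroups
are `ℓ`-groups. -/
def IsProLGroup (ℓ : ℕ) (A : Type u) [Group A] [TopologicalSpace A] : Prop :=
  ∀ U : OpenNormalSubgroup A, IsPGroup ℓ (A ⧸ U.toSubgroup)

/-- `ℓ`-Frattini covers of profinite groups: continuous surjections with pro-`ℓ` kernel, for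
which no proper closed subgroup maps onto the target. -/
structure IsLFrattiniCover (ℓ : ℕ) {A : Type u} {B : Type v} [Group A] [TopologicalSpace A]
    [Group B] [TopologicalSpace B] (p : A →ₜ* B) : Prop where
  surjective : Function.Surjective p
  eq_top : ∀ K : Subgroup A, IsClosed (K : Set A) → K.map p.toMonoidHom = ⊤ → K = ⊤
  ker_isProL : IsProLGroup ℓ p.toMonoidHom.ker

/-- The universal `ℓ`-Frattini cover of `G`: an `ℓ`-Frattini cover of `G` by a profinite group
through which every `ℓ`-Frattini cover of `G` by a profinite group factors. -/
structure IsUniversalLFrattiniCover (ℓ : ℕ) {G : Type u} [Group G] [TopologicalSpace G]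
    {E : ProfiniteGrp.{u}} (ψ : E →ₜ* G) : Prop where
  isLFrattiniCover : IsLFrattiniCover ℓ ψ
  exists_factor : ∀ (F : ProfiniteGrp.{u}) (χ : F →ₜ* G), IsLFrattiniCover ℓ χ →
    ∃ θ : E →ₜ* F, χ.comp θ = ψ

/-! ### The characteristic module and the abelianized cover -/

section Char

variable {A : Type u} [Group A] [TopologicalSpace A] [IsTopologicalGroup A]

/-- For a subgroup `K`, the closed subgroup generated by the `ℓ`-th powers and the commutators
of elements of `K`; for `K` a pro-`ℓ` group this is its Frattini subgroup. -/
def frattiniSubgroup (ℓ : ℕ) (K : Subgroup A) : Subgroup A :=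
  (Subgroup.closure ({z | ∃ x ∈ K, x ^ ℓ = z} ∪
    {z | ∃ x ∈ K, ∃ y ∈ K, ⁅x, y⁆ = z})).topologicalClosure

theorem frattiniSubgroup_normal (ℓ : ℕ) (K : Subgroup A) [hK : K.Normal] :
    (frattiniSubgroup ℓ K).Normal := by
  have : (Subgroup.closure ({z | ∃ x ∈ K, x ^ ℓ = z} ∪
      {z | ∃ x ∈ K, ∃ y ∈ K, ⁅x, y⁆ = z})).Normal := by
    refine normal_closure_of_conj_mem ?_
    rintro g _ (⟨x, hx, rfl⟩ | ⟨x, hx, y, hy, rfl⟩)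
    · exact Or.inl ⟨g * x * g⁻¹, hK.conj_mem _ hx g, by simp [conj_pow]⟩
    · exact Or.inr ⟨g * x * g⁻¹, hK.conj_mem _ hx g, g * y * g⁻¹, hK.conj_mem _ hy g,
        by simp [commutatorElement_def, mul_assoc]⟩
  exact Subgroup.is_normal_topologicalClosure _

variable {G : Type v} [Group G] [TopologicalSpace G]

theorem charSection (ℓ : ℕ) (ψ : A →ₜ* G) (hψ : Function.Surjective ψ) :
    IsElemSection ℓ ψ.toMonoidHom ψ.toMonoidHom.ker
      (frattiniSubgroup ℓ ψ.toMonoidHom.ker) where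
  surj := hψ
  K_normal := inferInstance
  D_normal := frattiniSubgroup_normal ℓ _
  pow_mem x hx := Subgroup.le_topologicalClosure _ (Subgroup.subset_closure (Or.inl ⟨x, hx, rfl⟩))
  comm_mem x hx y hy := Subgroup.le_topologicalClosure _
    (Subgroup.subset_closure (Or.inr ⟨x, hx, y, hy, rfl⟩))
  triv_mem x hx y hy := Subgroup.le_topologicalClosure _
    (Subgroup.subset_closure (Or.inr ⟨x, hx, y, hy, rfl⟩))

/-- For `ψ` the universal `ℓ`-Frattini cover of `G`, the characteristic `ℤ/ℓ[G]`-module of `G`: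
the kernel of `ψ` modulo its Frattini subgroup. -/
noncomputable def charRep (ℓ : ℕ) (ψ : A →ₜ* G) (hψ : Function.Surjective ψ) :
    Representation (ZMod ℓ) G (SectionModule (charSection ℓ ψ hψ)) :=
  sectionRep (charSection ℓ ψ hψ)

/-- The closed commutator subgroup of the kernel of a cover. -/
def kerCommutator (ψ : A →ₜ* G) : Subgroup A :=
  (⁅ψ.toMonoidHom.ker, ψ.toMonoidHom.ker⁆ : Subgroup A).topologicalClosure

instance (ψ : A →ₜ* G) : (kerCommutator ψ).Normal :=
  Subgroup.is_normal_topologicalClosure _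

/-- The covering group of the abelianized cover attached to `ψ`. -/
abbrev AbCover (ψ : A →ₜ* G) : Type u := A ⧸ kerCommutator ψ

end Char

/-! ### Lattice kernels -/

section Lattice

variable {A : Type u} {B : Type v} [Group A] [Group B]

/-- The subgroup generated by the `n`-th powers of elements of the kernel of `p`. If the kernel
`L` is abelian, this is the subgroup `n L` of all `n`-th powers. -/
def kerPow (p : A →* B) (n : ℕ) : Subgroup A :=
  Subgroup.closure {z | ∃ x ∈ p.ker, x ^ n = z}

theorem kerPow_normal (p : A →* B) (n : ℕ) : (kerPow p n).Normal := by
  refine normal_closure_of_conj_mem ?_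
  rintro g _ ⟨x, hx, rfl⟩
  exact ⟨g * x * g⁻¹, p.normal_ker.conj_mem _ hx g, by simp [conj_pow]⟩

theorem kerPow_le (p : A →* B) (n : ℕ) : kerPow p n ≤ p.ker := by
  refine (Subgroup.closure_le _).2 ?_
  rintro _ ⟨x, hx, rfl⟩
  exact p.ker.pow_mem hx n

theorem exists_pow_of_mem_kerPow {p : A →* B}
    (hc : ∀ x ∈ p.ker, ∀ y ∈ p.ker, x * y = y * x) {n : ℕ} {z : A} (hz : z ∈ kerPow p n) :
    ∃ x ∈ p.ker, x ^ n = z := by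
  induction hz using Subgroup.closure_induction with
  | mem x hx => exact hx
  | one => exact ⟨1, one_mem _, one_pow n⟩
  | mul x y _ _ hx hy =>
    obtain ⟨a, ha, rfl⟩ := hx
    obtain ⟨b, hb, rfl⟩ := hy
    exact ⟨a * b, mul_mem ha hb, Commute.mul_pow (hc a ha b hb) n⟩
  | inv x _ hx =>
    obtain ⟨a, ha, rfl⟩ := hx
    exact ⟨a⁻¹, inv_mem ha, inv_pow a n⟩

/-- If the kernel `L` of the surjection `p : A → B` is abelian, `ℓ ^ k L / ℓ ^ (k + 1) L` is a
`ℤ/ℓ[B]`-module. -/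
theorem latticeSection (ℓ : ℕ) {p : A →* B} (hp : Function.Surjective p)
    (hc : ∀ x ∈ p.ker, ∀ y ∈ p.ker, x * y = y * x) (k : ℕ) :
    IsElemSection ℓ p (kerPow p (ℓ ^ k)) (kerPow p (ℓ ^ (k + 1))) where
  surj := hp
  K_normal := kerPow_normal p _
  D_normal := kerPow_normal p _
  pow_mem x hx := by
    obtain ⟨y, hy, rfl⟩ := exists_pow_of_mem_kerPow hc hx
    exact Subgroup.subset_closure ⟨y, hy, by rw [← pow_mul, ← pow_succ]⟩
  comm_mem x hx y hy := by
    rw [commutatorElement_eq_one_iff_mul_comm.2 (hc x (kerPow_le p _ hx) y (kerPow_le p _ hy))]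
    exact one_mem _
  triv_mem x hx y hy := by
    rw [commutatorElement_eq_one_iff_mul_comm.2 (hc x hx y (kerPow_le p _ hy))]
    exact one_mem _

theorem mem_kerPow_pow_zero {p : A →* B} (ℓ : ℕ) {x : A} (hx : x ∈ p.ker) :
    x ∈ kerPow p (ℓ ^ 0) :=
  Subgroup.subset_closure ⟨x, hx, by simp⟩

end Lattice

/-! ### The semidirect products `(ℤ/n)^t ⋊ H` -/

section Semidirect

/-- The group `(ℤ/n)^t`, written multiplicatively. -/
abbrev ZPow (n t : ℕ) : Type := Multiplicative (Fin t → ZMod n)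

/-- The coordinatewise reduction `(ℤ/ℓ²)^t → (ℤ/ℓ)^t`. -/
def redHom (ℓ t : ℕ) : ZPow (ℓ ^ 2) t →* ZPow ℓ t :=
  AddMonoidHom.toMultiplicative
    { toFun := fun v i => ZMod.castHom (dvd_pow_self ℓ two_ne_zero) (ZMod ℓ) (v i)
      map_zero' := by ext i; simp
      map_add' := by intro v w; ext i; simp }

variable {ℓ t : ℕ} {H : Type u} [Group H]
  {φ₂ : H →* MulAut (ZPow (ℓ ^ 2) t)} {φ₁ : H →* MulAut (ZPow ℓ t)}

/-- The homomorphism `(ℤ/ℓ²)^t ⋊ H → (ℤ/ℓ)^t ⋊ H` that is reduction modulo `ℓ` on the first factor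
and the identity on `H`, for an action `φ₂` of `H` that reduces to `φ₁`. -/
def redMap (h : ∀ g v, redHom ℓ t (φ₂ g v) = φ₁ g (redHom ℓ t v)) :
    ZPow (ℓ ^ 2) t ⋊[φ₂] H →* ZPow ℓ t ⋊[φ₁] H :=
  SemidirectProduct.map (redHom ℓ t) (MonoidHom.id H) (fun g => MonoidHom.ext (h g))

theorem redHom_surjective (ℓ t : ℕ) : Function.Surjective (redHom ℓ t) := by
  intro w
  have hs := ZMod.castHom_surjective (dvd_pow_self ℓ two_ne_zero : ℓ ∣ ℓ ^ 2)
  choose s hs using hs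
  exact ⟨Multiplicative.ofAdd (fun i => s (Multiplicative.toAdd w i)), by
    apply Multiplicative.toAdd.injective
    funext i
    exact hs _⟩

theorem redHom_pow (ℓ t : ℕ) (v : ZPow (ℓ ^ 2) t) (hv : redHom ℓ t v = 1) : v ^ ℓ = 1 := by
  apply Multiplicative.toAdd.injective
  funext i
  have h0 : ZMod.castHom (dvd_pow_self ℓ two_ne_zero) (ZMod ℓ) (Multiplicative.toAdd v i) = 0 :=
    congrFun (congrArg Multiplicative.toAdd hv) i
  change ℓ • (Multiplicative.toAdd v i) = 0
  obtain ⟨z, hz⟩ := ZMod.intCast_surjective (Multiplicative.toAdd v i)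
  rw [← hz, map_intCast, ZMod.intCast_zmod_eq_zero_iff_dvd] at h0
  obtain ⟨c, rfl⟩ := h0
  rw [← hz, nsmul_eq_mul]
  have h1 : ((ℓ ^ 2 : ℕ) : ZMod (ℓ ^ 2)) = 0 := ZMod.natCast_self _
  push_cast at h1 ⊢
  rw [← mul_assoc, ← pow_two, h1, zero_mul]

theorem redMap_ker (h : ∀ g v, redHom ℓ t (φ₂ g v) = φ₁ g (redHom ℓ t v))
    {x : ZPow (ℓ ^ 2) t ⋊[φ₂] H} (hx : x ∈ (redMap h).ker) :
    ∃ v, redHom ℓ t v = 1 ∧ x = SemidirectProduct.inl v := by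
  have h1 := congrArg SemidirectProduct.left (MonoidHom.mem_ker.1 hx)
  have h2 := congrArg SemidirectProduct.right (MonoidHom.mem_ker.1 hx)
  refine ⟨x.left, h1, ?_⟩
  ext1
  · rfl
  · exact h2

/-- The kernel of `redMap` is a `ℤ/ℓ[(ℤ/ℓ)^t ⋊ H]`-module. -/
theorem redSection (h : ∀ g v, redHom ℓ t (φ₂ g v) = φ₁ g (redHom ℓ t v)) :
    IsElemSection ℓ (redMap h) (redMap h).ker ⊥ where
  surj x := by
    obtain ⟨v, hv⟩ := redHom_surjective ℓ t x.left
    refine ⟨⟨v, x.right⟩, ?_⟩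
    ext1
    · exact hv
    · rfl
  K_normal := inferInstance
  D_normal := inferInstance
  pow_mem x hx := by
    obtain ⟨v, hv, rfl⟩ := redMap_ker h hx
    rw [Subgroup.mem_bot, ← map_pow, redHom_pow ℓ t v hv, map_one]
  comm_mem x hx y hy := by
    obtain ⟨v, hv, rfl⟩ := redMap_ker h hx
    obtain ⟨w, hw, rfl⟩ := redMap_ker h hy
    rw [Subgroup.mem_bot, commutatorElement_eq_one_iff_mul_comm, ← map_mul, ← map_mul, mul_comm]
  triv_mem x hx y hy := by
    obtain ⟨v, hv, rfl⟩ := redMap_ker h hx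
    obtain ⟨w, hw, rfl⟩ := redMap_ker h hy
    rw [Subgroup.mem_bot, commutatorElement_eq_one_iff_mul_comm, ← map_mul, ← map_mul, mul_comm]

/-- `π` is the canonical map `G = N ⋊ H → N' ⋊ H`, where `N' = N / fr(N)` is the quotient of the
`ℓ`-group `N` by its Frattini subgroup and is identified with `(ℤ/ℓ)^t`. -/
structure IsFrattiniQuotientMap {G : Type u} [Group G] [TopologicalSpace G]
    [IsTopologicalGroup G] (N H : Subgroup G) {φ₁ : H →* MulAut (ZPow ℓ t)}
    (π : G →* ZPow ℓ t ⋊[φ₁] H) : Prop where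
  surjective : Function.Surjective π
  ker_eq : π.ker = frattiniSubgroup ℓ N
  map_N : ∀ n ∈ N, (π n).right = 1
  map_H : ∀ h : H, π h = SemidirectProduct.inr h

end Semidirect

end LFrattini

/-! Since `|H|` is prime to `ℓ`, the representation `M` of `H` on `N / fr(N) = (ℤ/ℓ)^t` lifts to a
representation `A` on `ℤ_ℓ^t` (`exists_padic_lift`): averaging over `H` turns a map that is
multiplicative mod `ℓ^k` into one that is multiplicative mod `ℓ^(2k)`, and compactness supplies a
limit. Reducing `A` mod `ℓ²` gives `μ`.

All claims about the universal cover come from one auxiliary cover. Inside the fibre product of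
`ℤ_ℓ^t ⋊ H` and `G` over `(ℤ/ℓ)^t ⋊ H`, a minimal closed subgroup mapping onto `G` is an
`ℓ`-Frattini cover `G⋆ → G` (`exists_isLatticeCover`). Its kernel `L` embeds in `ℤ_ℓ^t`. The part of
`G⋆` above `N` projects to a closed subgroup of `ℤ_ℓ^t` that is everything mod `ℓ`, hence is
everything; taking `|N|`-th powers shows `|N| ℤ_ℓ^t ⊆ L`, so `L` has full rank
(`IsLatticeCover.pow_nsmul_mem_lattice`).

The lattice `L` is not explicit, but its reduction is: between stable lattices `ℓ Y' ⊆ Y ⊆ Y'`, the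
modules `Y / ℓ Y` and `Y' / ℓ Y'` are built from the same two pieces, and both extensions split by
Maschke (`exists_reduction_of_le`). A chain of such steps gives `ℓ^k L / ℓ^(k+1) L ≅ M'` for all
`k`.

By universality `ψ` factors through `G⋆` by some `θ`, which is onto because `G⋆ → G` is Frattini. As
`L` is abelian, `θ` descends to `ν`; on kernels it induces `f`; and its coordinate in `ℤ_ℓ^t`, taken
mod `ℓ²`, lifts `π ∘ ψ` through `μ`.

The universal cover itself is again a minimal closed subgroup, in a completion of the free group on
the set `G` that maps to every extension of `G` by a pro-`ℓ` group (`exists_freeProL_lift`). -/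

namespace LFrattini

open scoped commutatorElement
open Filter Topology

/-! ### Maps out of an elementary abelian section -/

section Sections

variable {A : Type u} {B : Type v} [Group A] [Group B] {ℓ : ℕ} {p : A →* B} {K D : Subgroup A}

theorem SectionModule.mk_mul (h : IsElemSection ℓ p K D) (x y : K) :
    SectionModule.mk h (x * y) = SectionModule.mk h x + SectionModule.mk h y := rfl

theorem SectionModule.mk_eq_zero_iff (h : IsElemSection ℓ p K D) (x : K) :
    SectionModule.mk h x = 0 ↔ (x : A) ∈ D := by
  have := h.normal_subgroupOf
  exact (QuotientGroup.eq_one_iff (N := D.subgroupOf K) x).trans Subgroup.mem_subgroupOf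

/-- An equivariant homomorphism on `K` that kills `D` induces an intertwining map on `K / D`. -/
theorem exists_intertwiningMap_of_section (h : IsElemSection ℓ p K D) {V : Type*} [AddCommGroup V]
    [Module (ZMod ℓ) V] (ρ : Representation (ZMod ℓ) B V) (F : K →* Multiplicative V)
    (hD : ∀ x : K, (x : A) ∈ D → F x = 1)
    (hF : ∀ (a : A) (x : K), Multiplicative.toAdd (F ⟨a * x * a⁻¹, h.K_normal.conj_mem _ x.2 a⟩) =
      ρ (p a) (Multiplicative.toAdd (F x))) :
    ∃ f : Representation.IntertwiningMap (sectionRep h) ρ,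
      ∀ x, f (SectionModule.mk h x) = Multiplicative.toAdd (F x) := by
  have := h.normal_subgroupOf
  let f₀ : SectionModule h →+ V := MonoidHom.toAdditiveLeft
    (QuotientGroup.lift (D.subgroupOf K) F fun x hx => hD x (Subgroup.mem_subgroupOf.1 hx))
  have hf₀ : ∀ x, f₀ (SectionModule.mk h x) = Multiplicative.toAdd (F x) := fun x => rfl
  refine ⟨⟨f₀.toZModLinearMap ℓ, fun b => ?_⟩, hf₀⟩
  obtain ⟨a, rfl⟩ := h.surj b
  ext x
  obtain ⟨y, rfl⟩ := SectionModule.exists_mk h x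
  change f₀ (sectionRep h (p a) (SectionModule.mk h y)) = ρ (p a) (f₀ (SectionModule.mk h y))
  rw [sectionRep_mk, hf₀, hf₀, hF]

/-- A surjective equivariant homomorphism on `K` with kernel `D` induces an isomorphism of
representations on `K / D`. -/
theorem exists_equiv_of_section (h : IsElemSection ℓ p K D) {V : Type*} [AddCommGroup V]
    [Module (ZMod ℓ) V] (ρ : Representation (ZMod ℓ) B V) (F : K →* Multiplicative V)
    (hsurj : Function.Surjective F) (hD : ∀ x : K, F x = 1 ↔ (x : A) ∈ D)
    (hF : ∀ (a : A) (x : K), Multiplicative.toAdd (F ⟨a * x * a⁻¹, h.K_normal.conj_mem _ x.2 a⟩) =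
      ρ (p a) (Multiplicative.toAdd (F x))) :
    ∃ f : Representation.Equiv (sectionRep h) ρ,
      ∀ x, f (SectionModule.mk h x) = Multiplicative.toAdd (F x) := by
  obtain ⟨f, hf⟩ := exists_intertwiningMap_of_section h ρ F (fun x => (hD x).2) hF
  have hbij : Function.Bijective f.toLinearMap := by
    refine ⟨(injective_iff_map_eq_zero _).2 fun x hx => ?_, fun y => ?_⟩
    · obtain ⟨z, rfl⟩ := SectionModule.exists_mk h x
      rw [Representation.IntertwiningMap.toLinearMap_apply, hf] at hx
      exact (SectionModule.mk_eq_zero_iff h z).2 ((hD z).1 hx)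
    · obtain ⟨z, hz⟩ := hsurj (Multiplicative.ofAdd y)
      exact ⟨SectionModule.mk h z, by
        rw [Representation.IntertwiningMap.toLinearMap_apply, hf, hz]; rfl⟩
  exact ⟨Representation.Equiv.mk (LinearEquiv.ofBijective f.toLinearMap hbij)
    fun g => f.isIntertwining' g, hf⟩

end Sections

/-! ### Minimal closed subgroups and `ℓ`-Frattini covers -/

section Covers

variable {A : Type u} [Group A] [TopologicalSpace A] {B : Type v} [Group B] [TopologicalSpace B]

/-- An open subgroup absorbs `x ^ ℓ ^ k` for some `k`. Unlike the definition, this criterion passes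
to subgroups without any work. -/
theorem isProLGroup_of_tendsto (ℓ : ℕ)
    (h : ∀ x : A, Tendsto (fun k : ℕ => x ^ ℓ ^ k) atTop (𝓝 1)) : IsProLGroup ℓ A := by
  intro U x
  induction x using QuotientGroup.induction_on with | H x => ?_
  have hU : (U.toSubgroup : Set A) ∈ 𝓝 (1 : A) := U.isOpen'.mem_nhds U.one_mem
  obtain ⟨k, hk⟩ := ((h x).eventually_mem hU).exists
  exact ⟨k, (QuotientGroup.eq_one_iff (N := U.toSubgroup) (x ^ ℓ ^ k)).2 hk⟩

/-- Among the closed subgroups of a compact group that map onto `B`, there is a minimal one. -/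
theorem exists_minimal_closed_subgroup [CompactSpace A] [T1Space B] (p : A →ₜ* B)
    (hp : Function.Surjective p) :
    ∃ K : Subgroup A, IsClosed (K : Set A) ∧ K.map p.toMonoidHom = ⊤ ∧
      ∀ K' : Subgroup A, IsClosed (K' : Set A) → K' ≤ K → K'.map p.toMonoidHom = ⊤ → K' = K := by
  let S : Set (Subgroup A) := {K | IsClosed (K : Set A) ∧ K.map p.toMonoidHom = ⊤}
  have htop : (⊤ : Subgroup A) ∈ S := by
    refine ⟨isClosed_univ, ?_⟩
    rw [← MonoidHom.range_eq_map]
    exact MonoidHom.range_eq_top.2 hp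
  -- Zorn for the reversed order: a chain is bounded by its intersection.
  obtain ⟨K, -, hK⟩ := zorn_le_nonempty₀ (OrderDual.ofDual ⁻¹' S) (fun c hc hchain y hy => by
    have hne : Nonempty c := ⟨⟨y, hy⟩⟩
    let k : c → Subgroup A := fun K => OrderDual.ofDual K.1
    have hk : ∀ K, k K ∈ S := fun K => hc K.2
    refine ⟨OrderDual.toDual (⨅ K, k K), ⟨?_, ?_⟩, fun z hz =>
      show (⨅ K, k K) ≤ k ⟨z, hz⟩ from iInf_le k ⟨z, hz⟩⟩
    · rw [OrderDual.ofDual_toDual, Subgroup.coe_iInf]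
      exact isClosed_iInter fun K => (hk K).1
    · rw [OrderDual.ofDual_toDual]
      refine eq_top_iff.2 fun b _ => ?_
      have hb : IsClosed (p ⁻¹' {b}) := isClosed_singleton.preimage p.continuous_toFun
      -- The fibres over `b` in the members of the chain are nested nonempty compact sets, so the
      -- intersection still meets the fibre.
      obtain ⟨x, hx⟩ := IsCompact.nonempty_iInter_of_directed_nonempty_isCompact_isClosed
        (fun K => (k K : Set A) ∩ p ⁻¹' {b}) (by
          intro K K'
          rcases hchain.total K.2 K'.2 with h | h
          · exact ⟨K', Set.inter_subset_inter_left _ h, subset_rfl⟩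
          · exact ⟨K, subset_rfl, Set.inter_subset_inter_left _ h⟩) (by
          intro K
          have : b ∈ (k K).map p.toMonoidHom := by
            rw [(hk K).2]; trivial
          obtain ⟨x, hx, rfl⟩ := this
          exact ⟨x, hx, rfl⟩) (fun K => ((hk K).1.inter hb).isCompact)
          (fun K => (hk K).1.inter hb)
      have hx' := Set.mem_iInter.1 hx
      exact ⟨x, (Subgroup.mem_iInf).2 fun K => (hx' K).1, (hx' hne.some).2⟩)
    (OrderDual.toDual ⊤) htop
  exact ⟨OrderDual.ofDual K, hK.1.1, hK.1.2, fun K' h1 h2 h3 =>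
    le_antisymm h2 (hK.2 (y := OrderDual.toDual K') ⟨h1, h3⟩ h2)⟩

/-- The restriction of a continuous homomorphism to a subgroup. -/
def restrictHom (K : Subgroup A) (p : A →ₜ* B) : K →ₜ* B where
  toMonoidHom := p.toMonoidHom.comp K.subtype
  continuous_toFun := p.continuous_toFun.comp continuous_subtype_val

/-- A continuous surjection whose kernel consists of elements with `x ^ (ℓ ^ k) → 1` restricts
to an `ℓ`-Frattini cover on some closed subgroup. -/
theorem exists_closed_isLFrattiniCover [CompactSpace A] [T1Space B] (ℓ : ℕ) (p : A →ₜ* B)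
    (hp : Function.Surjective p)
    (hker : ∀ x : A, p x = 1 → Tendsto (fun k : ℕ => x ^ ℓ ^ k) atTop (𝓝 1)) :
    ∃ K : Subgroup A, IsClosed (K : Set A) ∧ IsLFrattiniCover ℓ (restrictHom K p) := by
  obtain ⟨K, hK, hmap, hmin⟩ := exists_minimal_closed_subgroup p hp
  refine ⟨K, hK, fun b => ?_, fun K' hK' hmap' => ?_, ?_⟩
  · have : b ∈ K.map p.toMonoidHom := by rw [hmap]; trivial
    obtain ⟨x, hx, rfl⟩ := this
    exact ⟨⟨x, hx⟩, rfl⟩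
  · have h1 := hmin (K'.map K.subtype)
      (hK.isClosedEmbedding_subtypeVal.isClosedMap _ hK')
      (Subgroup.map_subtype_le _) (by rw [Subgroup.map_map]; exact hmap')
    refine Subgroup.map_injective K.subtype_injective ?_
    rw [h1, ← MonoidHom.range_eq_map, Subgroup.range_subtype]
  · refine isProLGroup_of_tendsto ℓ fun x => ?_
    refine tendsto_subtype_rng.2 (tendsto_subtype_rng.2 ?_)
    exact hker x.1.1 x.2

end Covers

/-! ### Existence of the universal `ℓ`-Frattini cover -/

section UniversalCover

variable (ℓ : ℕ) (G : Type u) [Group G]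

/-- The tautological surjection of the free group on the set `G`. -/
def freeCover : FreeGroup G →* G := FreeGroup.lift id

theorem freeCover_surjective : Function.Surjective (freeCover G) :=
  fun g => ⟨FreeGroup.of g, by simp [freeCover]⟩

/-- The finite index normal subgroups `U` of the free group on `G` below the kernel `R` of the
map onto `G`, such that `R / U` is an `ℓ`-group. -/
structure ProLIndex where
  /-- the subgroup -/
  subgroup : Subgroup (FreeGroup G)
  normal : subgroup.Normal
  finiteIndex : subgroup.FiniteIndex
  pow_mem : ∀ r ∈ (freeCover G).ker, ∃ k : ℕ, r ^ ℓ ^ k ∈ subgroup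

variable {ℓ G}

/-- The finite quotient of the free group attached to `U`. -/
def ProLIndex.Quot (U : ProLIndex ℓ G) : Type u := FreeGroup G ⧸ U.subgroup

instance (U : ProLIndex ℓ G) : Group U.Quot :=
  haveI := U.normal
  inferInstanceAs (Group (FreeGroup G ⧸ U.subgroup))

instance (U : ProLIndex ℓ G) : TopologicalSpace U.Quot := ⊥

instance (U : ProLIndex ℓ G) : DiscreteTopology U.Quot := ⟨rfl⟩

instance (U : ProLIndex ℓ G) : Finite U.Quot :=
  haveI := U.finiteIndex
  inferInstanceAs (Finite (FreeGroup G ⧸ U.subgroup))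

/-- The quotient map of the free group attached to `U`. -/
def ProLIndex.toQuot (U : ProLIndex ℓ G) : FreeGroup G →* U.Quot :=
  haveI := U.normal
  QuotientGroup.mk' U.subgroup

theorem ProLIndex.toQuot_eq_one (U : ProLIndex ℓ G) (w : FreeGroup G) :
    U.toQuot w = 1 ↔ w ∈ U.subgroup := by
  have := U.normal
  exact QuotientGroup.eq_one_iff w

variable (ℓ G)

/-- The diagonal map of the free group on `G` to the product of `G` and all its finite quotients
that are extensions of `G` by an `ℓ`-group. -/
def diagHom : FreeGroup G →* G × (∀ U : ProLIndex ℓ G, U.Quot) :=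
  (freeCover G).prod (MonoidHom.pi fun U => U.toQuot)

variable [TopologicalSpace G] [DiscreteTopology G]

/-- The completion of the free group on `G` with respect to the finite quotients that are
extensions of `G` by an `ℓ`-group. -/
abbrev FreeProL : Type u := (diagHom ℓ G).range.topologicalClosure

/-- The map of the completion onto `G`. -/
def freeProLHom : FreeProL ℓ G →ₜ* G :=
  restrictHom _ (ContinuousMonoidHom.fst G (∀ U : ProLIndex ℓ G, U.Quot))

theorem freeProLHom_surjective : Function.Surjective (freeProLHom ℓ G) := by
  intro g
  obtain ⟨w, hw⟩ := freeCover_surjective G g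
  exact ⟨⟨diagHom ℓ G w, Subgroup.le_topologicalClosure _ ⟨w, rfl⟩⟩, hw⟩

variable {ℓ G}

/-- In the coordinate `U`, the element `x` agrees with a word `w` in the kernel of `freeCover`, and
an `ℓ`-power of `w` dies there; so each coordinate of `x ^ ℓ ^ k` is eventually trivial. -/
theorem tendsto_pow_of_freeProLHom_eq_one (x : FreeProL ℓ G) (hx : freeProLHom ℓ G x = 1) :
    Tendsto (fun k : ℕ => x ^ ℓ ^ k) atTop (𝓝 1) := by
  refine tendsto_subtype_rng.2 (Prod.tendsto_iff _ _ |>.2 ⟨?_, tendsto_pi_nhds.2 fun U => ?_⟩)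
  · refine tendsto_const_nhds.congr fun k => ?_
    change _ = (freeProLHom ℓ G (x ^ ℓ ^ k))
    rw [map_pow, hx, one_pow]
    rfl
  · have hopen : IsOpen {y : G × (∀ U : ProLIndex ℓ G, U.Quot) |
        y.1 = x.1.1 ∧ y.2 U = x.1.2 U} := by
      refine ((isOpen_discrete {x.1.1}).preimage continuous_fst).inter
        ((isOpen_discrete {x.1.2 U}).preimage ((continuous_apply U).comp continuous_snd))
    obtain ⟨_, ⟨h1, h2⟩, ⟨w, rfl⟩⟩ := mem_closure_iff.1 x.2 _ hopen ⟨rfl, rfl⟩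
    have hw : w ∈ (freeCover G).ker := h1.trans hx
    obtain ⟨k, hk⟩ := U.pow_mem w hw
    have h3 : x.1.2 U ^ ℓ ^ k = 1 := by
      rw [← h2]
      change U.toQuot w ^ ℓ ^ k = 1
      rw [← map_pow, U.toQuot_eq_one]
      exact hk
    refine tendsto_const_nhds.congr' ?_
    filter_upwards [eventually_ge_atTop k] with n hn
    change 1 = x.1.2 U ^ ℓ ^ n
    obtain ⟨m, rfl⟩ := Nat.exists_eq_add_of_le hn
    rw [pow_add, pow_mul, h3, one_pow]

/-- The completion maps to every extension of `G` by a pro-`ℓ` group. -/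
theorem exists_freeProL_lift [Finite G] (F : ProfiniteGrp.{u}) (χ : F →ₜ* G)
    (hsurj : Function.Surjective χ) (hker : IsProLGroup ℓ χ.toMonoidHom.ker) :
    ∃ θ : FreeProL ℓ G →ₜ* F, χ.comp θ = freeProLHom ℓ G := by
  let φ : FreeGroup G →* F := FreeGroup.lift (Function.surjInv hsurj)
  have hφ : ∀ w, χ (φ w) = freeCover G w := by
    intro w
    have : χ.toMonoidHom.comp φ = freeCover G := by
      ext g
      simp [φ, freeCover, Function.surjInv_eq]
    exact DFunLike.congr_fun this w
  let W := G × (∀ U : ProLIndex ℓ G, U.Quot)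
  -- The closure of the graph of `φ`. It turns out to be the graph of the desired `θ`: its
  -- projection `q` to the completion is bijective.
  let C : Subgroup (W × F) := ((diagHom ℓ G).prod φ).range.topologicalClosure
  have hCcl : IsClosed (C : Set (W × F)) := Subgroup.isClosed_topologicalClosure _
  have : CompactSpace C := isCompact_iff_compactSpace.1 hCcl.isCompact
  have hind : ∀ S : Set (W × F), IsClosed S → (∀ w, (diagHom ℓ G w, φ w) ∈ S) →
      ∀ z ∈ C, z ∈ S := by
    intro S hS h z hz
    refine closure_minimal ?_ hS hz
    rintro _ ⟨w, rfl⟩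
    exact h w
  have hCχ : ∀ z ∈ C, χ z.2 = z.1.1 := by
    refine hind {z | χ z.2 = z.1.1} (isClosed_eq ?_ ?_) fun w => hφ w
    · exact χ.continuous_toFun.comp continuous_snd
    · exact continuous_fst.comp continuous_fst
  have hCP : ∀ z ∈ C, z.1 ∈ (diagHom ℓ G).range.topologicalClosure := by
    refine hind {z | z.1 ∈ (diagHom ℓ G).range.topologicalClosure} ?_ fun w =>
      Subgroup.le_topologicalClosure _ ⟨w, rfl⟩
    exact (Subgroup.isClosed_topologicalClosure _).preimage continuous_fst
  let q : C →* FreeProL ℓ G :=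
    ((MonoidHom.fst W F).comp C.subtype).codRestrict _ fun z => hCP z z.2
  have hqc : Continuous q :=
    (continuous_fst.comp continuous_subtype_val).subtype_mk _
  have hqi : Function.Injective q := by
    refine (injective_iff_map_eq_one q).2 ?_
    rintro ⟨⟨x, f⟩, hz⟩ h
    have hx : x = 1 := congrArg Subtype.val h
    subst hx
    by_contra hne
    have hf : f ≠ 1 := by
      rintro rfl
      exact hne rfl
    have hχo : IsOpen (χ.toMonoidHom.ker : Set F) :=
      (isOpen_discrete {(1 : G)}).preimage χ.continuous_toFun
    -- If `(1, f)` lies in `C` with `f ≠ 1`, an open normal `V` avoids `f`. Its preimage in the free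
    -- group is one of the indices `U`, because the kernel of `χ` is pro-`ℓ`.
    obtain ⟨V, hV⟩ := ProfiniteGrp.exist_openNormalSubgroup_sub_open_nhds_of_one
      (U := {f}ᶜ ∩ (χ.toMonoidHom.ker : Set F)) (isOpen_compl_singleton.inter hχo)
      ⟨fun h => hf h.symm, one_mem _⟩
    have hVn : V.toSubgroup.Normal := V.isNormal'
    have hVf : V.toSubgroup.FiniteIndex := Subgroup.finiteIndex_of_finite_quotient
    let U : ProLIndex ℓ G :=
      { subgroup := V.toSubgroup.comap φ
        normal := inferInstance
        finiteIndex := ⟨by rw [Subgroup.index_comap]; exact Subgroup.FiniteIndex.index_ne_zero⟩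
        pow_mem := by
          intro r hr
          have hr' : φ r ∈ χ.toMonoidHom.ker := (hφ r).trans hr
          let V' : OpenNormalSubgroup χ.toMonoidHom.ker :=
            { toSubgroup := V.toSubgroup.subgroupOf _
              isOpen' := V.isOpen'.preimage continuous_subtype_val }
          obtain ⟨k, hk⟩ := hker V' (QuotientGroup.mk ⟨φ r, hr'⟩)
          refine ⟨k, ?_⟩
          rw [← QuotientGroup.mk_pow, QuotientGroup.eq_one_iff] at hk
          change φ (r ^ ℓ ^ k) ∈ V.toSubgroup
          rw [map_pow]
          exact hk }
    have hopen : IsOpen {z : W × F | z.1.2 U = 1 ∧ f⁻¹ * z.2 ∈ V.toSubgroup} :=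
      ((isOpen_discrete {(1 : U.Quot)}).preimage
        ((continuous_apply U).comp (continuous_snd.comp continuous_fst))).inter
        (V.isOpen'.preimage (continuous_const.mul continuous_snd))
    -- Approximate `(1, f)` by a word `w`: triviality in the coordinate `U` puts `φ w` in `V`, while
    -- `φ w` is congruent to `f` mod `V`.
    obtain ⟨_, ⟨h1, h2⟩, ⟨w, rfl⟩⟩ := mem_closure_iff.1 hz _ hopen
      ⟨rfl, by simp⟩
    have hw : φ w ∈ V.toSubgroup := (U.toQuot_eq_one w).1 h1
    have hfV : f ∈ V.toSubgroup := by
      have := mul_mem hw (inv_mem h2)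
      simpa using this
    exact (hV hfV).1 rfl
  have hqs : Function.Surjective q := by
    have hcl : IsClosed (Prod.fst '' (C : Set (W × F))) :=
      (hCcl.isCompact.image continuous_fst).isClosed
    intro x
    have hx : x.1 ∈ Prod.fst '' (C : Set (W × F)) := by
      refine closure_minimal ?_ hcl x.2
      rintro _ ⟨w, rfl⟩
      exact ⟨(diagHom ℓ G w, φ w), Subgroup.le_topologicalClosure _ ⟨w, rfl⟩, rfl⟩
    obtain ⟨z, hz, hzx⟩ := hx
    exact ⟨⟨z, hz⟩, Subtype.ext hzx⟩
  let e : C ≃* FreeProL ℓ G := MulEquiv.ofBijective q ⟨hqi, hqs⟩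
  -- A continuous bijection from a compact space to a Hausdorff space is a homeomorphism.
  have hec : Continuous e.symm :=
    (Continuous.homeoOfEquivCompactToT2 (f := e.toEquiv) hqc).symm.continuous
  refine ⟨⟨((MonoidHom.snd W F).comp C.subtype).comp e.symm.toMonoidHom,
    (continuous_snd.comp continuous_subtype_val).comp hec⟩, ?_⟩
  ext x
  obtain ⟨z, rfl⟩ := e.surjective x
  change χ ((e.symm (e z)).1.2) = z.1.1.1
  rw [e.symm_apply_apply]
  exact hCχ z z.2

/-- Universality only asks for a factorization, not a surjective one, so lifts from the completion
may simply be restricted to a minimal closed subgroup over `G`. -/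
theorem exists_isUniversalLFrattiniCover [Finite G] (ℓ : ℕ) :
    ∃ (E : ProfiniteGrp.{u}) (ψ : E →ₜ* G), IsUniversalLFrattiniCover ℓ ψ := by
  have : CompactSpace (FreeProL ℓ G) :=
    isCompact_iff_compactSpace.1 (Subgroup.isClosed_topologicalClosure _).isCompact
  obtain ⟨K, hK, hcov⟩ := exists_closed_isLFrattiniCover ℓ (freeProLHom ℓ G)
    (freeProLHom_surjective ℓ G) tendsto_pow_of_freeProLHom_eq_one
  have : CompactSpace K := isCompact_iff_compactSpace.1 hK.isCompact
  refine ⟨ProfiniteGrp.of K, restrictHom K (freeProLHom ℓ G), hcov, fun F χ hχ => ?_⟩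
  obtain ⟨θ, hθ⟩ := exists_freeProL_lift F χ hχ.surjective hχ.ker_isProL
  refine ⟨restrictHom K θ, ?_⟩
  ext x
  exact DFunLike.congr_fun hθ x.1

end UniversalCover

/-! ### Lifting representations of `H` from `ℤ/ℓ` to `ℤ_ℓ` -/

section Lifting

/-- Averaging turns a map to a ring that is multiplicative modulo a central element `c` into one
that is multiplicative modulo `c ^ 2`. -/
theorem exists_multiplicative_mod_sq {A : Type*} [Ring A] {H : Type*} [Group H] [Fintype H]
    {a c : A}
    (ha : a * (Fintype.card H : A) = 1) (hc : ∀ x, Commute c x) {s : H → A}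
    (hs : ∀ h, IsUnit (s h)) (hmul : ∀ g h, c ∣ s (g * h) - s g * s h) :
    ∃ s' : H → A, (∀ g, c ∣ s' g - s g) ∧ ∀ g h, c * c ∣ s' (g * h) - s' g * s' h := by
  choose u hu using fun h => (hs h).exists_right_inv
  have hu' : ∀ h, u h * s h = 1 := fun h => by
    obtain ⟨b, hb⟩ := (hs h).exists_left_inv
    rw [← left_inv_eq_right_inv hb (hu h), hb]
  have hcd : ∀ x y : A, c ∣ y → c ∣ x * y := by
    rintro x _ ⟨z, rfl⟩
    exact ⟨x * z, by rw [← mul_assoc, ← mul_assoc, (hc x).eq]⟩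
  set n : A := (Fintype.card H : A) with hn
  have hna : n * a = 1 := by rw [hn, (Nat.cast_commute _ a).eq, ← hn, ha]
  -- `X g h = s (g h) (s h)⁻¹` is an approximation of `s g` for each `h`; `s' g` is its average over
  -- `h`, with `a` the inverse of `|H|`.
  let X : H → H → A := fun g h => s (g * h) * u h
  obtain ⟨s', hs'⟩ : ∃ s' : H → A, ∀ g, s' g = a * ∑ h, X g h := ⟨_, fun _ => rfl⟩
  have hns : ∀ g, n * s' g = ∑ h, X g h := fun g => by
    rw [hs', ← mul_assoc, hna, one_mul]
  have hXs : ∀ g h, c ∣ X g h - s g := fun g h => by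
    have : X g h - s g = (s (g * h) - s g * s h) * u h := by
      simp only [X]; rw [sub_mul, mul_assoc (s g), hu, mul_one]
    rw [this]
    exact (hmul g h).mul_right _
  have hs's : ∀ g, c ∣ s' g - s g := fun g => by
    have : s' g - s g = a * ∑ h, (X g h - s g) := by
      rw [hs', Finset.sum_sub_distrib, mul_sub, Finset.sum_const, Finset.card_univ, nsmul_eq_mul,
        ← mul_assoc a, ← hn, ha, one_mul]
    rw [this]
    exact hcd _ _ (Finset.dvd_sum fun h _ => hXs g h)
  have hXs' : ∀ g h, c ∣ X g h - s' g := fun g h => by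
    have : X g h - s' g = (X g h - s g) - (s' g - s g) := by abel
    rw [this]
    exact dvd_sub (hXs g h) (hs's g)
  refine ⟨s', hs's, fun g g' => ?_⟩
  -- An exact identity, and the reason for choosing `X`: the inner factors `s (g' h)` cancel.
  have hXX : ∀ h, X g (g' * h) * X g' h = X (g * g') h := fun h => by
    simp only [X]
    rw [mul_assoc, ← mul_assoc (u _) (s _), hu', one_mul, mul_assoc]
  have hsum : ∑ h, X g (g' * h) = n * s' g := by
    rw [hns]
    exact Fintype.sum_equiv (Equiv.mulLeft g') _ _ fun h => rfl
  -- The failure of multiplicativity is a covariance: the average of products of deviations from the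
  -- mean. Each deviation is divisible by `c`, hence the product by `c * c`.
  have key : s' (g * g') - s' g * s' g' =
      a * ∑ h, (X g (g' * h) - s' g) * (X g' h - s' g') := by
    have : ∑ h, (X g (g' * h) - s' g) * (X g' h - s' g') =
        n * (s' (g * g') - s' g * s' g') := by
      simp only [sub_mul, mul_sub, Finset.sum_sub_distrib, hXX]
      rw [← hns, ← Finset.sum_mul, hsum, ← Finset.mul_sum, ← hns, Finset.sum_const,
        Finset.card_univ, nsmul_eq_mul, ← hn]
      have : s' g * (n * s' g') = n * (s' g * s' g') := by
        rw [← mul_assoc, ← (Nat.cast_commute (Fintype.card H) (s' g)).eq, mul_assoc]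
      rw [this, mul_assoc, sub_self, sub_zero]
    rw [this, ← mul_assoc, ha, one_mul]
  rw [key]
  obtain ⟨z, hz⟩ : c * c ∣ ∑ h, (X g (g' * h) - s' g) * (X g' h - s' g') := by
    refine Finset.dvd_sum fun h _ => ?_
    obtain ⟨y, hy⟩ := hXs' g (g' * h)
    obtain ⟨z, hz⟩ := hXs' g' h
    rw [hy, hz]
    exact ⟨y * z, by rw [mul_assoc, ← mul_assoc y, ← (hc y).eq]; simp only [mul_assoc]⟩
  rw [hz]
  exact ⟨a * z, by rw [← mul_assoc, ← ((hc a).mul_left (hc a)).eq, mul_assoc]⟩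

variable {ℓ : ℕ} [Fact ℓ.Prime]

theorem dvd_of_toZMod_eq_zero {x : ℤ_[ℓ]} (hx : PadicInt.toZMod x = 0) : (ℓ : ℤ_[ℓ]) ∣ x := by
  have : x ∈ RingHom.ker (PadicInt.toZMod : ℤ_[ℓ] →+* ZMod ℓ) := hx
  rwa [PadicInt.ker_toZMod, PadicInt.maximalIdeal_eq_span_p, Ideal.mem_span_singleton] at this

theorem isUnit_of_toZMod_ne_zero {x : ℤ_[ℓ]} (hx : PadicInt.toZMod x ≠ 0) : IsUnit x := by
  by_contra h
  refine hx ?_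
  change x ∈ RingHom.ker (PadicInt.toZMod : ℤ_[ℓ] →+* ZMod ℓ)
  rw [PadicInt.ker_toZMod]
  exact h

theorem toZMod_surjective : Function.Surjective (PadicInt.toZMod : ℤ_[ℓ] →+* ZMod ℓ) :=
  fun x => ⟨(ZMod.cast x : ℤ_[ℓ]), by
    obtain ⟨n, rfl⟩ := ZMod.natCast_zmod_surjective x
    have h := PadicInt.toZMod_spec (p := ℓ) ((n : ℕ) : ℤ_[ℓ])
    rw [← PadicInt.ker_toZMod, RingHom.mem_ker, map_sub, sub_eq_zero, map_natCast] at h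
    exact h.symm⟩

variable {t : ℕ} {H : Type u} [Group H] [Finite H]

instance (t : ℕ) : CompactSpace (Matrix (Fin t) (Fin t) ℤ_[ℓ]) :=
  inferInstanceAs (CompactSpace (Fin t → Fin t → ℤ_[ℓ]))

local notation "𝓐" => Matrix (Fin t) (Fin t) ℤ_[ℓ]

/-- A representation of a group of order prime to `ℓ` over `ℤ/ℓ` lifts to `ℤ_ℓ`. -/
theorem exists_padic_lift (hcop : (Nat.card H).Coprime ℓ)
    (M : H →* Matrix (Fin t) (Fin t) (ZMod ℓ)) :
    ∃ M' : H →* Matrix (Fin t) (Fin t) ℤ_[ℓ],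
      ∀ h, (M' h).map PadicInt.toZMod = M h := by
  have := Fintype.ofFinite H
  let red : 𝓐 →+* Matrix (Fin t) (Fin t) (ZMod ℓ) := PadicInt.toZMod.mapMatrix
  have hred0 : ∀ x : 𝓐, red x = 0 → (ℓ : 𝓐) ∣ x := by
    intro x hx
    have : ∀ i j, (ℓ : ℤ_[ℓ]) ∣ x i j := fun i j =>
      dvd_of_toZMod_eq_zero (congrFun (congrFun hx i) j)
    choose z hz using this
    refine ⟨Matrix.of z, ?_⟩
    ext i j
    rw [hz, ← nsmul_eq_mul, ← nsmul_eq_mul]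
    rfl
  have hredd : ∀ x : 𝓐, (ℓ : 𝓐) ∣ x → red x = 0 := by
    rintro _ ⟨z, rfl⟩
    rw [map_mul, map_natCast]
    have : (ℓ : Matrix (Fin t) (Fin t) (ZMod ℓ)) = 0 := by
      ext i j
      simp [Matrix.natCast_apply]
    rw [this, zero_mul]
  -- The determinant is a unit because it is nonzero mod `ℓ`.
  have hunit : ∀ (x : 𝓐) (h : H), red x = M h → IsUnit x := by
    intro x h hx
    rw [Matrix.isUnit_iff_isUnit_det]
    refine isUnit_of_toZMod_ne_zero ?_
    rw [RingHom.map_det]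
    change (red x).det ≠ 0
    rw [hx]
    exact (((Group.isUnit h).map M).map Matrix.detMonoidHom).ne_zero
  have hcl : ∀ c : 𝓐, IsClosed {x : 𝓐 | c ∣ x} := by
    intro c
    have : {x : 𝓐 | c ∣ x} = Set.range fun z => c * z := by
      ext x
      exact ⟨fun ⟨z, hz⟩ => ⟨z, hz.symm⟩, fun ⟨z, hz⟩ => ⟨z, hz.symm⟩⟩
    rw [this]
    exact (isCompact_range (continuous_const.mul continuous_id)).isClosed
  obtain ⟨a, ha⟩ : ∃ a : 𝓐, a * (Fintype.card H : 𝓐) = 1 := by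
    have h1 : IsUnit ((Fintype.card H : ℕ) : ℤ_[ℓ]) := by
      refine isUnit_of_toZMod_ne_zero ?_
      rw [map_natCast, Ne, ZMod.natCast_eq_zero_iff, ← Nat.card_eq_fintype_card]
      exact (Nat.Prime.coprime_iff_not_dvd Fact.out).1 hcop.symm
    have h2 := h1.map (algebraMap ℤ_[ℓ] 𝓐)
    rw [map_natCast] at h2
    exact h2.exists_left_inv
  have hredsurj : Function.Surjective red := by
    intro y
    choose z hz using fun i j => toZMod_surjective (y i j)
    exact ⟨Matrix.of z, by ext i j; exact hz i j⟩
  choose s₀ hs₀ using fun h => hredsurj (M h)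
  -- Lifts of `M` that are multiplicative mod `ℓ ^ (k + 1)`. The shift makes any set-theoretic lift
  -- a member of `C 0`. These are nested nonempty compact sets, and a common point is an exact lift.
  let C : ℕ → Set (H → 𝓐) := fun k => {s | (∀ g, (ℓ : 𝓐) ∣ s g - s₀ g) ∧
    ∀ g h, (ℓ : 𝓐) ^ (k + 1) ∣ s (g * h) - s g * s h}
  have hCred : ∀ s : H → 𝓐, (∀ g, (ℓ : 𝓐) ∣ s g - s₀ g) → ∀ g, red (s g) = M g := by
    intro s hs g
    have := hredd _ (hs g)
    rw [map_sub, sub_eq_zero] at this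
    rw [this, hs₀]
  have hCclosed : ∀ k, IsClosed (C k) := by
    intro k
    have : C k = (⋂ g, (fun s => s g - s₀ g) ⁻¹' {x : 𝓐 | (ℓ : 𝓐) ∣ x}) ∩
        ⋂ g, ⋂ h, (fun s => s (g * h) - s g * s h) ⁻¹' {x : 𝓐 | (ℓ : 𝓐) ^ (k + 1) ∣ x} := by
      ext s
      simp [C]
    rw [this]
    have hc : ∀ g, Continuous fun s : H → 𝓐 => s g := fun g => continuous_apply g
    have hc₁ : ∀ g, Continuous fun s : H → 𝓐 => s g - s₀ g := fun g => (hc g).sub continuous_const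
    have hc₂ : ∀ g h, Continuous fun s : H → 𝓐 => s (g * h) - s g * s h := fun g h =>
      (hc (g * h)).sub ((hc g).mul (hc h))
    exact (isClosed_iInter fun g => (hcl _).preimage (hc₁ g)).inter
      (isClosed_iInter fun g => isClosed_iInter fun h => (hcl _).preimage (hc₂ g h))
  have hCanti : ∀ k, C (k + 1) ⊆ C k := fun k s hs =>
    ⟨hs.1, fun g h => (pow_dvd_pow _ (Nat.le_succ _)).trans (hs.2 g h)⟩
  have hCne : ∀ k, (C k).Nonempty := by
    intro k
    induction k with
    | zero =>
      refine ⟨s₀, fun g => by simp, fun g h => ?_⟩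
      rw [zero_add, pow_one]
      refine hred0 _ ?_
      rw [map_sub, map_mul, hs₀, hs₀, hs₀, map_mul, sub_self]
    | succ k ih =>
      obtain ⟨s, hs1, hs2⟩ := ih
      -- Applied with `c = ℓ ^ (k + 1)`, this gives multiplicativity mod `ℓ ^ (2k + 2)`, which is
      -- more than `C (k + 1)` demands.
      obtain ⟨s', h1, h2⟩ := exists_multiplicative_mod_sq ha
        (fun x => (Nat.cast_commute ℓ x).pow_left (k + 1))
        (fun h => hunit _ h (hCred s hs1 h)) hs2
      refine ⟨s', fun g => ?_, fun g h => ?_⟩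
      · have : s' g - s₀ g = (s' g - s g) + (s g - s₀ g) := by abel
        rw [this]
        exact dvd_add ((dvd_pow_self _ (Nat.succ_ne_zero k)).trans (h1 g)) (hs1 g)
      · refine dvd_trans ?_ (h2 g h)
        rw [← pow_add]
        exact pow_dvd_pow _ (by omega)
  obtain ⟨s, hs⟩ := IsCompact.nonempty_iInter_of_sequence_nonempty_isCompact_isClosed C hCanti hCne
    (hCclosed 0).isCompact hCclosed
  rw [Set.mem_iInter] at hs
  have hsred := hCred s (hs 0).1
  have hsmul : ∀ g h, s (g * h) = s g * s h := by
    intro g h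
    rw [← sub_eq_zero]
    ext i j
    refine PadicInt.ext_of_toZModPow.1 fun k => ?_
    obtain ⟨z, hz⟩ := (pow_dvd_pow _ (Nat.le_succ k)).trans ((hs k).2 g h)
    rw [hz, ← Nat.cast_pow, ← nsmul_eq_mul, Matrix.smul_apply, nsmul_eq_mul, map_mul, map_natCast,
      ZMod.natCast_self, zero_mul, Matrix.zero_apply, map_zero]
  have hs1 : s 1 = 1 := by
    have h1 := hsmul 1 1
    rw [one_mul] at h1
    exact (hunit _ 1 (hsred 1)).mul_left_cancel (by rw [← h1, mul_one])
  exact ⟨⟨⟨s, hs1⟩, hsmul⟩, hsred⟩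

end Lifting

/-! ### Maschke's theorem and reductions of stable sublattices -/

section Lattices

variable {ℓ : ℕ} [Fact ℓ.Prime] {H : Type*} [Group H] [Finite H]
  {X V : Type*} [AddCommGroup X] [AddCommGroup V]

/-- A homomorphism from a subgroup `Z` of `Y` extends to `Y` if it kills the elements of `Z` that
are multiples of `ℓ` in `Y`. -/
theorem exists_addMonoidHom_extension {Y : Type*} [AddCommGroup Y] (Z : AddSubgroup Y) (g : Z →+ V)
    (hg : ∀ (y : Y) (hy : ℓ • y ∈ Z), g ⟨ℓ • y, hy⟩ = 0) :
    ∃ g' : Y →+ V, ∀ z : Z, g' z = g z := by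
  -- `Y / ℓ Y` is a `ℤ/ℓ`-vector space and `g` factors through the image of `Z` in it; the
  -- retraction `r` onto that subspace extends the map.
  let D : AddSubgroup Y := (nsmulAddMonoidHom ℓ : Y →+ Y).range
  let k : Z →+ Y ⧸ D := (QuotientAddGroup.mk' D).comp Z.subtype
  have hM : ∀ m : Y ⧸ D, ℓ • m = 0 := by
    intro m
    induction m using QuotientAddGroup.induction_on with | H y => ?_
    exact (QuotientAddGroup.eq_zero_iff (ℓ • y)).2 ⟨y, rfl⟩
  have hki := QuotientAddGroup.kerLift_injective k
  have hN : ∀ m : Z ⧸ k.ker, ℓ • m = 0 := fun m => hki (by rw [map_nsmul, hM, map_zero])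
  have hgk : k.ker ≤ g.ker := by
    rintro ⟨z, hz⟩ h
    obtain ⟨y, rfl⟩ := (QuotientAddGroup.eq_zero_iff z).1 (AddMonoidHom.mem_ker.1 h)
    exact hg y hz
  obtain ⟨r, hr⟩ : ∃ r : Y ⧸ D →+ Z ⧸ k.ker, ∀ n, r (QuotientAddGroup.kerLift k n) = n := by
    let := AddCommGroup.zmodModule hM
    let := AddCommGroup.zmodModule hN
    obtain ⟨r, hr⟩ := LinearMap.exists_leftInverse_of_injective
      ((QuotientAddGroup.kerLift k).toZModLinearMap ℓ) (LinearMap.ker_eq_bot.2 hki)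
    exact ⟨r.toAddMonoidHom, LinearMap.congr_fun hr⟩
  refine ⟨((QuotientAddGroup.lift k.ker g hgk).comp r).comp (QuotientAddGroup.mk' D), fun z => ?_⟩
  have : r (k z) = QuotientAddGroup.mk z := hr (QuotientAddGroup.mk z)
  change QuotientAddGroup.lift k.ker g hgk (r (k z)) = g z
  rw [this]
  rfl

variable {a : H →* AddMonoid.End X} {b : H →* AddMonoid.End V}

/-- Maschke's theorem, in the form of an extension property. -/
theorem exists_equivariant_extension (hcop : (Nat.card H).Coprime ℓ) (hV : ∀ v : V, ℓ • v = 0)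
    {Y Z : AddSubgroup X} (hZY : Z ≤ Y)
    (hY : ∀ h, ∀ y ∈ Y, a h y ∈ Y) (hZ : ∀ h, ∀ z ∈ Z, a h z ∈ Z) (g : Z →+ V)
    (hg : ∀ y ∈ Y, ∀ hy : ℓ • y ∈ Z, g ⟨ℓ • y, hy⟩ = 0)
    (hgb : ∀ h (z : Z), g ⟨a h z, hZ h z z.2⟩ = b h (g z)) :
    ∃ g' : Y →+ V, (∀ z (hz : z ∈ Z), g' ⟨z, hZY hz⟩ = g ⟨z, hz⟩) ∧
      ∀ h (y : Y), g' ⟨a h y, hY h y y.2⟩ = b h (g' y) := by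
  have := Fintype.ofFinite H
  obtain ⟨g₀, hg₀⟩ := exists_addMonoidHom_extension (Z.addSubgroupOf Y)
    (g.comp (AddSubgroup.addSubgroupOfEquivOfLe hZY).toAddMonoidHom)
    (fun y hy => hg y y.2 (AddSubgroup.mem_addSubgroupOf.1 hy))
  have hg₀' : ∀ z (hz : z ∈ Z), g₀ ⟨z, hZY hz⟩ = g ⟨z, hz⟩ := fun z hz =>
    hg₀ ⟨⟨z, hZY hz⟩, AddSubgroup.mem_addSubgroupOf.2 hz⟩
  -- `c` inverts `|H|` mod `ℓ`, hence on `V`; it normalizes the average over `H` of the conjugates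
  -- of the non-equivariant extension `g₀`.
  obtain ⟨c, -, hc⟩ := Nat.exists_mul_mod_eq_one_of_coprime hcop (Fact.out : ℓ.Prime).one_lt
  have hcV : ∀ v : V, c • Fintype.card H • v = v := by
    intro v
    rw [Nat.card_eq_fintype_card] at hc
    rw [← mul_smul, mul_comm, ← Nat.div_add_mod (Fintype.card H * c) ℓ, hc, add_smul, one_smul,
      mul_comm, mul_smul, hV, smul_zero, zero_add]
  let a' : H → Y →+ Y := fun h => ((a h).comp Y.subtype).codRestrict Y fun y => hY h y y.2
  let g' : Y →+ V := c • ∑ h : H, (b h).comp (g₀.comp (a' h⁻¹))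
  have hg' : ∀ y, g' y = c • ∑ h : H, b h (g₀ (a' h⁻¹ y)) := fun y => by
    simp only [g', AddMonoidHom.nsmul_apply, AddMonoidHom.finsetSum_apply]
    rfl
  refine ⟨g', fun z hz => ?_, fun h y => ?_⟩
  · have : ∀ h : H, b h (g₀ (a' h⁻¹ ⟨z, hZY hz⟩)) = g ⟨z, hz⟩ := by
      intro h
      have h1 : g₀ (a' h⁻¹ ⟨z, hZY hz⟩) = g ⟨a h⁻¹ z, hZ h⁻¹ z hz⟩ := hg₀' _ (hZ h⁻¹ z hz)
      rw [h1, ← hgb]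
      congr 2
      change (a h * a h⁻¹) z = z
      rw [← map_mul, mul_inv_cancel, map_one]
      rfl
    rw [hg', Finset.sum_congr rfl fun h _ => this h, Finset.sum_const, Finset.card_univ, hcV]
  · rw [hg', hg', map_nsmul, map_sum]
    congr 1
    refine (Fintype.sum_equiv (Equiv.mulLeft h) _ _ fun k => ?_).symm
    change (b h * b k) _ = b (h * k) _
    rw [← map_mul]
    congr 2
    ext
    change a k⁻¹ y = (a (h * k)⁻¹ * a h) y
    rw [← map_mul]
    congr 2
    group

/-- Here `V = Y' / ℓ Y'` contains `P = Y / ℓ Y'` with quotient `Y' / Y`, while `Y / ℓ Y` has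
quotient `Y / ℓ Y'` and submodule `ℓ Y' / ℓ Y ≅ Y' / Y`. Maschke splits both extensions. Concretely
`F = F' + ρ ∘ g'`, where `F'` sees the part `P` and `g'` extends `ℓ y ↦ ρ (F' y)` from `ℓ Y'` to
`Y`. -/
theorem exists_reduction_of_le (hcop : (Nat.card H).Coprime ℓ) (hX : ∀ x : X, ℓ • x = 0 → x = 0)
    (hV : ∀ v : V, ℓ • v = 0)
    {Y Y' : AddSubgroup X} (hYY' : Y ≤ Y') (hYY : ∀ y ∈ Y', ℓ • y ∈ Y)
    (hY : ∀ h, ∀ y ∈ Y, a h y ∈ Y) (hY' : ∀ h, ∀ y ∈ Y', a h y ∈ Y') (F' : Y' →+ V)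
    (hsurj : Function.Surjective F') (hker : ∀ y : Y', F' y = 0 ↔ ∃ z ∈ Y', ℓ • z = y)
    (hF' : ∀ h (y : Y'), F' ⟨a h y, hY' h y y.2⟩ = b h (F' y)) :
    ∃ F : Y →+ V, Function.Surjective F ∧ (∀ y : Y, F y = 0 ↔ ∃ z ∈ Y, ℓ • z = y) ∧
      ∀ h (y : Y), F ⟨a h y, hY h y y.2⟩ = b h (F y) := by
  let i : Y →+ Y' := AddSubgroup.inclusion hYY'
  let P : AddSubgroup V := (F'.comp i).range
  have hP : ∀ h, ∀ v ∈ P, b h v ∈ P := by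
    rintro h _ ⟨y, rfl⟩
    exact ⟨⟨a h y, hY h y y.2⟩, hF' h (i y)⟩
  let bP : H →* AddMonoid.End P :=
    { toFun := fun h => ((b h).comp P.subtype).codRestrict P fun v => hP h v v.2
      map_one' := by
        ext v
        change b 1 v = v
        rw [map_one]
        rfl
      map_mul' := fun h k => by
        ext v
        change b (h * k) v = _
        rw [map_mul]
        rfl }
  -- Extending the identity of `P` yields an equivariant projection `π` of `V` onto `P`; then `ρ = 1
  -- - π` has kernel `P`.
  obtain ⟨π₀, hπ₀, hπb₀⟩ := exists_equivariant_extension (ℓ := ℓ) (a := b) (b := bP) hcop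
    (fun v => Subtype.ext (hV v)) (le_top : P ≤ ⊤) (fun _ _ _ => trivial) hP (AddMonoidHom.id P)
    (fun v _ _ => Subtype.ext (hV v)) (fun _ _ => rfl)
  let π : V →+ V := (P.subtype.comp π₀).comp AddSubgroup.topEquiv.symm.toAddMonoidHom
  have hπP : ∀ v, π v ∈ P := fun v => (π₀ ⟨v, trivial⟩).2
  have hπ : ∀ v ∈ P, π v = v := fun v hv => congrArg Subtype.val (hπ₀ v hv)
  have hπb : ∀ h v, π (b h v) = b h (π v) := fun h v =>
    congrArg Subtype.val (hπb₀ h ⟨v, trivial⟩)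
  let ρ : V →+ V := AddMonoidHom.id V - π
  have hρ : ∀ v, ρ v = v - π v := fun v => rfl
  have hπρ : ∀ v, π (ρ v) = 0 := fun v => by rw [hρ, map_sub, hπ (π v) (hπP v), sub_self]
  have hρρ : ∀ v, ρ (ρ v) = ρ v := fun v => by rw [hρ (ρ v), hπρ, sub_zero]
  have hρP : ∀ v, ρ v = 0 ↔ v ∈ P := fun v => by
    refine ⟨fun h => ?_, fun h => by rw [hρ, hπ v h, sub_self]⟩
    rw [hρ, sub_eq_zero] at h
    rw [h]
    exact hπP v
  have hρb : ∀ h v, ρ (b h v) = b h (ρ v) := fun h v => by rw [hρ, hρ, hπb, map_sub]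
  -- `m.range` is `ℓ Y'`; as `X` has no `ℓ`-torsion, division by `ℓ` is well defined on it.
  let m : Y' →+ X := (nsmulAddMonoidHom ℓ : X →+ X).comp Y'.subtype
  have hm : Function.Injective m :=
    (injective_iff_map_eq_zero m).2 fun y hy => Subtype.ext (hX _ hy)
  let e : Y' ≃+ m.range := AddMonoidHom.ofInjective hm
  let g : m.range →+ V := (ρ.comp F').comp e.symm.toAddMonoidHom
  have hmr : ∀ y ∈ Y', ℓ • y ∈ m.range := fun y hy => ⟨⟨y, hy⟩, rfl⟩
  have hge : ∀ (y : X) (hy : y ∈ Y') (hz : ℓ • y ∈ m.range), g ⟨ℓ • y, hz⟩ = ρ (F' ⟨y, hy⟩) := by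
    intro y hy hz
    change ρ (F' (e.symm ⟨ℓ • y, hz⟩)) = _
    have : e.symm ⟨ℓ • y, hz⟩ = ⟨y, hy⟩ := e.symm_apply_eq.2 rfl
    rw [this]
  have hmY : m.range ≤ Y := by
    rintro _ ⟨y, rfl⟩
    exact hYY y y.2
  have hmst : ∀ h, ∀ z ∈ m.range, a h z ∈ m.range := by
    rintro h _ ⟨y, rfl⟩
    exact ⟨⟨a h y, hY' h y y.2⟩, (map_nsmul (a h) ℓ (y : X)).symm⟩
  -- The extension criterion holds since `y ∈ Y` has `F' y ∈ P`, which `ρ` kills.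
  obtain ⟨g', hg', hg'b⟩ := exists_equivariant_extension (ℓ := ℓ) (a := a) (b := b) hcop hV hmY
    hY hmst g (fun y hy hz => by
      rw [hge y (hYY' hy) hz, hρP]
      exact ⟨⟨y, hy⟩, rfl⟩) (by
      rintro h ⟨_, ⟨y, rfl⟩⟩
      have h1 := hge (a h y) (hY' h y y.2) (hmr _ (hY' h y y.2))
      have h2 := hge y y.2 (hmr y y.2)
      rw [hF', hρb, ← h2] at h1
      refine Eq.trans ?_ h1
      congr 2
      exact map_nsmul (a h) ℓ (y : X))
  have hg'e : ∀ (y : X) (hy : y ∈ Y'), g' ⟨ℓ • y, hYY y hy⟩ = ρ (F' ⟨y, hy⟩) := fun y hy => by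
    rw [← hge y hy (hmr y hy), ← hg']
  have hF'0 : ∀ (y : X) (hy : y ∈ Y'), F' ⟨ℓ • y, hYY' (hYY y hy)⟩ = 0 := fun y hy =>
    (hker _).2 ⟨y, hy, rfl⟩
  let F : Y →+ V := F'.comp i + ρ.comp g'
  have hF : ∀ y (hy : y ∈ Y), F ⟨y, hy⟩ = F' ⟨y, hYY' hy⟩ + ρ (g' ⟨y, hy⟩) := fun y hy => rfl
  refine ⟨F, fun v => ?_, ?_, ?_⟩
  -- `y` accounts for the component `π v`; adding `ℓ y'` leaves `F'` unchanged and corrects the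
  -- complementary component.
  · obtain ⟨y, hy⟩ := hπP v
    obtain ⟨⟨y', hy'⟩, hyv⟩ := hsurj (v - g' y)
    refine ⟨y + ⟨ℓ • y', hYY y' hy'⟩, ?_⟩
    have hy2 : F' ⟨y, hYY' y.2⟩ = π v := hy
    rw [map_add, hF, hF, hF'0 y' hy', hg'e y' hy', hρρ, hyv, zero_add, hy2, map_sub, hρ v]
    abel
  · rintro ⟨y, hy⟩
    constructor
    · intro h
      rw [hF] at h
      have h1 : F' ⟨y, hYY' hy⟩ = 0 := by
        have := congrArg π h
        have hyP : F' ⟨y, hYY' hy⟩ ∈ P := ⟨⟨y, hy⟩, rfl⟩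
        rwa [map_add, hπρ, map_zero, add_zero, hπ _ hyP] at this
      obtain ⟨z, hz, rfl⟩ := (hker _).1 h1
      rw [h1, zero_add, hg'e z hz, hρρ, hρP] at h
      obtain ⟨y₀, hy₀⟩ := h
      have h2 : F' (⟨z, hz⟩ - i y₀) = 0 := by
        rw [map_sub, sub_eq_zero]
        exact hy₀.symm
      obtain ⟨w, hw, hwz⟩ := (hker _).1 h2
      refine ⟨z, ?_, rfl⟩
      have : z = ℓ • w + y₀ := by
        rw [hwz]
        change z = z - y₀ + y₀
        abel
      rw [this]
      exact add_mem (hYY w hw) y₀.2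
    · rintro ⟨z, hz, rfl⟩
      rw [hF, hF'0 z (hYY' hz), hg'e z (hYY' hz), hρρ, zero_add, hρP]
      exact ⟨⟨z, hz⟩, rfl⟩
  · rintro h ⟨y, hy⟩
    rw [hF, hF, hg'b h ⟨y, hy⟩, hρb, map_add, ← hF' h ⟨y, hYY' hy⟩]

/-- If `X / ℓ X = V`, then `Y / ℓ Y` is isomorphic to `V` for every sublattice `Y` of `X`. -/
theorem exists_reduction (hcop : (Nat.card H).Coprime ℓ) (hX : ∀ x : X, ℓ • x = 0 → x = 0)
    (hV : ∀ v : V, ℓ • v = 0) (F₀ : X →+ V)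
    (hsurj : Function.Surjective F₀) (hker : ∀ x, F₀ x = 0 ↔ ∃ z, ℓ • z = x)
    (hF₀ : ∀ h x, F₀ (a h x) = b h (F₀ x)) (m : ℕ) {Y : AddSubgroup X}
    (hY : ∀ h, ∀ y ∈ Y, a h y ∈ Y) (hm : ∀ x : X, ℓ ^ m • x ∈ Y) :
    ∃ F : Y →+ V, Function.Surjective F ∧ (∀ y : Y, F y = 0 ↔ ∃ z ∈ Y, ℓ • z = y) ∧
      ∀ h (y : Y), F ⟨a h y, hY h y y.2⟩ = b h (F y) := by
  induction m generalizing Y with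
  | zero =>
    have hall : ∀ x, x ∈ Y := fun x => by simpa using hm x
    refine ⟨F₀.comp Y.subtype, fun v => ?_, fun y => ?_, fun h y => hF₀ h y⟩
    · obtain ⟨x, rfl⟩ := hsurj v
      exact ⟨⟨x, hall x⟩, rfl⟩
    · refine (hker y).trans ⟨fun ⟨z, hz⟩ => ⟨z, hall z, hz⟩, fun ⟨z, _, hz⟩ => ⟨z, hz⟩⟩
  | succ m ih =>
    -- `Y' = Y + ℓ^m X` falls under the induction hypothesis, and `ℓ Y' ⊆ Y` because `ℓ^(m+1) X ⊆
    -- Y`.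
    let Y' : AddSubgroup X := Y ⊔ (nsmulAddMonoidHom (ℓ ^ m) : X →+ X).range
    have hY' : ∀ h, ∀ y ∈ Y', a h y ∈ Y' := by
      intro h y hy
      obtain ⟨y, hyY, _, ⟨x, rfl⟩, rfl⟩ := AddSubgroup.mem_sup.1 hy
      rw [map_add]
      exact add_mem (AddSubgroup.mem_sup_left (hY h y hyY))
        (AddSubgroup.mem_sup_right ⟨a h x, (map_nsmul (a h) (ℓ ^ m) x).symm⟩)
    obtain ⟨F', h1, h2, h3⟩ := ih hY' fun x => AddSubgroup.mem_sup_right ⟨x, rfl⟩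
    refine exists_reduction_of_le hcop hX hV (le_sup_left : Y ≤ Y') ?_ hY hY' F' h1 h2 h3
    intro y hy
    obtain ⟨y, hyY, _, ⟨x, rfl⟩, rfl⟩ := AddSubgroup.mem_sup.1 hy
    rw [smul_add]
    refine add_mem (nsmul_mem hyY ℓ) ?_
    change ℓ • ℓ ^ m • x ∈ Y
    rw [← mul_smul, ← pow_succ']
    exact hm x

end Lattices

/-! ### The Frattini quotient of `N` and Burnside's basis theorem -/

section FrattiniQuotient

/-- In a finite `ℓ`-group, maximal subgroups contain all `ℓ`-th powers and commutators. -/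
theorem pow_mem_and_commutator_mem_of_isCoatom {ℓ : ℕ} [Fact ℓ.Prime] {Q : Type*} [Group Q]
    [Finite Q] (hQ : IsPGroup ℓ Q) {M : Subgroup Q} (hM : IsCoatom M) :
    (∀ x, x ^ ℓ ∈ M) ∧ ∀ x y : Q, ⁅x, y⁆ ∈ M := by
  -- Nilpotency makes `M` normal. By maximality `Q / M` has no proper nontrivial subgroup, so an
  -- element `b` of order `ℓ` generates it.
  have : Group.IsNilpotent Q := hQ.isNilpotent
  have hn : M.Normal := Subgroup.NormalizerCondition.normal_of_coatom M
    Group.normalizerCondition_of_isNilpotent hM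
  have hp : IsPGroup ℓ (Q ⧸ M) := hQ.to_quotient M
  have hnt : Nontrivial (Q ⧸ M) := QuotientGroup.nontrivial_iff.2 hM.1
  obtain ⟨k, hk⟩ := IsPGroup.iff_card.1 hp
  have hdvd : ℓ ∣ Nat.card (Q ⧸ M) := by
    rw [hk]
    refine dvd_pow_self ℓ ?_
    rintro rfl
    rw [pow_zero] at hk
    have := Finite.one_lt_card (α := Q ⧸ M)
    omega
  obtain ⟨b, hb⟩ := exists_prime_orderOf_dvd_card' ℓ hdvd
  have htop : Subgroup.zpowers b = ⊤ := by
    have hle : M ≤ (Subgroup.zpowers b).comap (QuotientGroup.mk' M) := fun x hx => by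
      rw [Subgroup.mem_comap, QuotientGroup.mk'_apply, (QuotientGroup.eq_one_iff x).2 hx]
      exact one_mem _
    rcases hle.eq_or_lt with h | h
    · exfalso
      obtain ⟨y, rfl⟩ := QuotientGroup.mk_surjective b
      have hy : y ∈ M := by
        rw [h]
        exact Subgroup.mem_zpowers _
      rw [(QuotientGroup.eq_one_iff y).2 hy, orderOf_one] at hb
      exact (Fact.out : ℓ.Prime).one_lt.ne hb
    · have h1 := hM.2 _ h
      refine eq_top_iff.2 fun z _ => ?_
      obtain ⟨y, rfl⟩ := QuotientGroup.mk_surjective z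
      have : y ∈ (Subgroup.zpowers b).comap (QuotientGroup.mk' M) := by
        rw [h1]
        trivial
      exact this
  have hz : ∀ x : Q, ∃ i : ℤ, b ^ i = (x : Q ⧸ M) := fun x => by
    have : (x : Q ⧸ M) ∈ Subgroup.zpowers b := by
      rw [htop]
      trivial
    exact this
  refine ⟨fun x => ?_, fun x y => ?_⟩
  · obtain ⟨i, hi⟩ := hz x
    rw [← QuotientGroup.eq_one_iff, QuotientGroup.mk_pow, ← hi, ← zpow_natCast, ← zpow_mul,
      mul_comm, zpow_mul, zpow_natCast, ← hb, pow_orderOf_eq_one, one_zpow]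
  · obtain ⟨i, hi⟩ := hz x
    obtain ⟨j, hj⟩ := hz y
    rw [← QuotientGroup.eq_one_iff]
    change ⁅(x : Q ⧸ M), (y : Q ⧸ M)⁆ = 1
    rw [← hi, ← hj, commutatorElement_eq_one_iff_mul_comm, ← zpow_add, ← zpow_add, add_comm]

/-- The projection of a semidirect product `N ⋊ H` of subgroups onto `H`. -/
theorem exists_complement_projection {G : Type*} [Group G] {N H : Subgroup G}
    [N.Normal] (hNH : N.IsComplement' H) :
    ∃ s : G →* H, s.ker = N ∧ ∀ h : H, s h = h := by
  let e := SemidirectProduct.mulEquivSubgroup hNH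
  have he : ∀ x, e x = (x.left : G) * (x.right : G) := fun x => rfl
  let s : G →* H := SemidirectProduct.rightHom.comp e.symm.toMonoidHom
  have hs : ∀ h : H, s h = h := fun h => by
    have : e.symm h = SemidirectProduct.inr h := by
      rw [MulEquiv.symm_apply_eq, he]
      simp
    change (e.symm h).right = h
    rw [this]
    rfl
  have hsN : ∀ n : N, s n = 1 := fun n => by
    have : e.symm n = SemidirectProduct.inl n := by
      rw [MulEquiv.symm_apply_eq, he]
      simp
    change (e.symm n).right = 1
    rw [this]
    rfl
  refine ⟨s, le_antisymm (fun g hg => ?_) (fun n hn => hsN ⟨n, hn⟩), hs⟩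
  obtain ⟨x, rfl⟩ := e.surjective g
  have h1 : x.right = 1 := by
    have : (e.symm (e x)).right = 1 := hg
    rwa [e.symm_apply_apply] at this
  rw [he, h1]
  simp

variable {ℓ : ℕ} [Fact ℓ.Prime] {G : Type u} [Group G] [Finite G]
  [TopologicalSpace G] [DiscreteTopology G]

/-- Mathlib's `frattini` is the intersection of the maximal subgroups. This inclusion makes its
non-generator property available modulo `frattiniSubgroup`. -/
theorem frattiniSubgroup_le_map_frattini {N : Subgroup G} (hN : IsPGroup ℓ N) :
    frattiniSubgroup ℓ N ≤ (frattini N).map N.subtype := by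
  have key : (∀ x : N, x ^ ℓ ∈ frattini N) ∧ ∀ x y : N, ⁅x, y⁆ ∈ frattini N := by
    simp only [frattini, Order.radical, Subgroup.mem_iInf]
    exact ⟨fun x M hM => (pow_mem_and_commutator_mem_of_isCoatom hN hM).1 x,
      fun x y M hM => (pow_mem_and_commutator_mem_of_isCoatom hN hM).2 x y⟩
  refine Subgroup.topologicalClosure_minimal _ ((Subgroup.closure_le _).2 ?_) (isClosed_discrete _)
  rintro _ (⟨x, hx, rfl⟩ | ⟨x, hx, y, hy, rfl⟩)
  · exact ⟨⟨x, hx⟩ ^ ℓ, key.1 _, rfl⟩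
  · exact ⟨⁅⟨x, hx⟩, ⟨y, hy⟩⁆, key.2 _ _, rfl⟩

/-- Burnside's basis theorem: the minimal number of generators of a finite `ℓ`-group is the
dimension of its Frattini quotient. -/
theorem finrank_section_eq_rank {B : Type v} [Group B] {p : G →* B} {N : Subgroup G}
    (hN : IsPGroup ℓ N) (h : IsElemSection ℓ p N (frattiniSubgroup ℓ N)) :
    Module.finrank (ZMod ℓ) (SectionModule h) = Group.rank N := by
  have hfin : Finite (SectionModule h) :=
    Finite.of_surjective _ fun x => SectionModule.exists_mk h x
  have : Module.Finite (ZMod ℓ) (SectionModule h) := Module.Finite.of_finite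
  refine le_antisymm ?_ ?_
  -- A generating set of `N` spans the quotient, which bounds the dimension.
  · obtain ⟨S, hS, hcl⟩ := Group.rank_spec N
    classical
    let T : Finset (SectionModule h) := S.image (SectionModule.mk h)
    have hspan : Submodule.span (ZMod ℓ) (T : Set (SectionModule h)) = ⊤ := by
      refine eq_top_iff.2 fun v _ => ?_
      obtain ⟨x, rfl⟩ := SectionModule.exists_mk h v
      have hx : x ∈ Subgroup.closure (S : Set N) := by
        rw [hcl]
        trivial
      induction hx using Subgroup.closure_induction with
      | mem x hx => exact Submodule.subset_span (Finset.mem_coe.2 (Finset.mem_image_of_mem _ hx))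
      | one => exact zero_mem _
      | mul x y _ _ hx hy => exact add_mem (hx trivial) (hy trivial)
      | inv x _ hx => exact neg_mem (hx trivial)
    rw [← finrank_top, ← hspan, ← hS]
    exact (finrank_span_finset_le_card T).trans Finset.card_image_le
  -- Conversely, lifts of a basis generate `N` up to `frattini N`, hence generate `N`.
  · let b := Module.finBasis (ZMod ℓ) (SectionModule h)
    choose x hx using fun i => SectionModule.exists_mk h (b i)
    classical
    let S : Finset N := Finset.univ.image x
    let K : Subgroup N := Subgroup.closure (S : Set N)
    have hK : ∀ v, ∃ k ∈ K, SectionModule.mk h k = v := by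
      let W : AddSubgroup (SectionModule h) :=
        { carrier := {v | ∃ k ∈ K, SectionModule.mk h k = v}
          add_mem' := by
            rintro _ _ ⟨k, hk, rfl⟩ ⟨l, hl, rfl⟩
            exact ⟨k * l, mul_mem hk hl, rfl⟩
          zero_mem' := ⟨1, one_mem _, rfl⟩
          neg_mem' := by
            rintro _ ⟨k, hk, rfl⟩
            exact ⟨k⁻¹, inv_mem hk, rfl⟩ }
      have hW : (AddSubgroup.toZModSubmodule ℓ W) = ⊤ := by
        rw [eq_top_iff, ← b.span_eq, Submodule.span_le]
        rintro _ ⟨i, rfl⟩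
        exact ⟨x i, Subgroup.subset_closure (by simp [S]), hx i⟩
      intro v
      have : v ∈ AddSubgroup.toZModSubmodule ℓ W := by
        rw [hW]
        trivial
      exact this
    have hKtop : K = ⊤ := by
      refine frattini_nongenerating (eq_top_iff.2 fun n _ => ?_)
      obtain ⟨k, hk, hkn⟩ := hK (SectionModule.mk h n)
      have h1 : SectionModule.mk h (k⁻¹ * n) = 0 := by
        have : SectionModule.mk h n = SectionModule.mk h k + SectionModule.mk h (k⁻¹ * n) := by
          rw [← SectionModule.mk_mul, mul_inv_cancel_left]
        rw [hkn] at this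
        exact (left_eq_add.1 this)
      obtain ⟨y, hy, hyn⟩ := frattiniSubgroup_le_map_frattini hN
        ((SectionModule.mk_eq_zero_iff h _).1 h1)
      have hy' : y = k⁻¹ * n := Subtype.ext hyn
      rw [← mul_inv_cancel_left k n, ← hy']
      exact mul_mem (Subgroup.mem_sup_left hk) (Subgroup.mem_sup_right hy)
    refine (Group.rank_le hKtop).trans (Finset.card_image_le.trans ?_)
    simp

/-- The Frattini quotient of `N` in coordinates, with the action of `H`. -/
theorem exists_frattini_coordinates (N : Sylow ℓ G) [(N : Subgroup G).Normal] {H : Subgroup G}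
    {s : G →* H} (hker : s.ker = N) (hs : ∀ h : H, s h = h) {t : ℕ} (ht : Group.rank N = t) :
    ∃ (q : N →* ZPow ℓ t) (M : H →* Matrix (Fin t) (Fin t) (ZMod ℓ)),
      Function.Surjective q ∧ (∀ n : N, q n = 1 ↔ (n : G) ∈ frattiniSubgroup ℓ (N : Subgroup G)) ∧
      ∀ (h : H) (n : N), Multiplicative.toAdd (q ⟨h * n * (h : G)⁻¹,
        Subgroup.Normal.conj_mem inferInstance _ n.2 _⟩) =
          (M h).mulVec (Multiplicative.toAdd (q n)) := by
  -- The section is taken along `s`, not along a cover: conjugation by `N = ker s` is trivial on `N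
  -- / fr(N)`, so `H` acts there.
  have hsec : IsElemSection ℓ s (N : Subgroup G) (frattiniSubgroup ℓ (N : Subgroup G)) :=
    { surj := fun h => ⟨h, hs h⟩
      K_normal := inferInstance
      D_normal := frattiniSubgroup_normal ℓ _
      pow_mem := fun x hx => Subgroup.le_topologicalClosure _
        (Subgroup.subset_closure (Or.inl ⟨x, hx, rfl⟩))
      comm_mem := fun x hx y hy => Subgroup.le_topologicalClosure _
        (Subgroup.subset_closure (Or.inr ⟨x, hx, y, hy, rfl⟩))
      triv_mem := fun x hx y hy => Subgroup.le_topologicalClosure _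
        (Subgroup.subset_closure (Or.inr ⟨x, hker.le hx, y, hy, rfl⟩)) }
  have hfin : Finite (SectionModule hsec) :=
    Finite.of_surjective _ fun x => SectionModule.exists_mk hsec x
  have : Module.Finite (ZMod ℓ) (SectionModule hsec) := Module.Finite.of_finite
  have hrank : Module.finrank (ZMod ℓ) (SectionModule hsec) = t :=
    (finrank_section_eq_rank N.isPGroup' hsec).trans ht
  let b := Module.finBasisOfFinrankEq (ZMod ℓ) (SectionModule hsec) hrank
  let e := b.equivFun
  let q : N →* ZPow ℓ t :=
    { toFun := fun n => Multiplicative.ofAdd (e (SectionModule.mk hsec n))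
      map_one' := congrArg Multiplicative.ofAdd (map_zero e)
      map_mul' := fun x y => congrArg Multiplicative.ofAdd
        (map_add e (SectionModule.mk hsec x) (SectionModule.mk hsec y)) }
  let M : H →* Matrix (Fin t) (Fin t) (ZMod ℓ) :=
    (LinearMap.toMatrixAlgEquiv b : _ →* _).comp (sectionRep hsec)
  refine ⟨q, M, fun v => ?_, fun n => ?_, fun h n => ?_⟩
  · obtain ⟨n, hn⟩ := SectionModule.exists_mk hsec (e.symm (Multiplicative.toAdd v))
    exact ⟨n, congrArg Multiplicative.ofAdd (by rw [hn, e.apply_symm_apply]; rfl)⟩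
  · rw [← SectionModule.mk_eq_zero_iff hsec, ← map_eq_zero_iff e e.injective]
    rfl
  · change e _ = (M h).mulVec (e (SectionModule.mk hsec n))
    have h1 := sectionRep_mk hsec (h : G) n
    rw [hs] at h1
    rw [← h1]
    exact (LinearMap.toMatrix_mulVec_repr b b (sectionRep hsec h) _).symm

end FrattiniQuotient

theorem conj_inl {N H : Type*} [CommGroup N] [Group H] {φ : H →* MulAut N} (a : N ⋊[φ] H) (v : N) :
    a * SemidirectProduct.inl v * a⁻¹ = SemidirectProduct.inl (φ a.right v) := by
  ext1
  · simp [mul_right_comm]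
  · simp

/-! ### Matrix actions, their reductions and the kernel of `μ` -/

section MatrixActions

variable {t : ℕ} {H : Type u} [Group H]

/-- The action of `H` on `S ^ t` given by a matrix representation. -/
def matAut {S : Type*} [CommRing S] (A : H →* Matrix (Fin t) (Fin t) S) :
    H →* MulAut (Multiplicative (Fin t → S)) where
  toFun h :=
    { toFun := fun v => Multiplicative.ofAdd ((A h).mulVec (Multiplicative.toAdd v))
      invFun := fun v => Multiplicative.ofAdd ((A h⁻¹).mulVec (Multiplicative.toAdd v))
      left_inv := fun v => by
        simp [Matrix.mulVec_mulVec, ← map_mul]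
      right_inv := fun v => by
        simp [Matrix.mulVec_mulVec, ← map_mul]
      map_mul' := fun v w => by
        simp [Matrix.mulVec_add] }
  map_one' := by
    ext v : 1
    change Multiplicative.ofAdd ((A 1).mulVec (Multiplicative.toAdd v)) = v
    simp
  map_mul' g h := by
    ext v : 1
    change Multiplicative.ofAdd ((A (g * h)).mulVec (Multiplicative.toAdd v)) =
      Multiplicative.ofAdd ((A g).mulVec ((A h).mulVec (Multiplicative.toAdd v)))
    rw [Matrix.mulVec_mulVec, map_mul]

/-- The linear representation of `H` on `S ^ t` given by a matrix representation. -/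
noncomputable def matRep {S : Type*} [CommRing S] (A : H →* Matrix (Fin t) (Fin t) S) :
    Representation S H (Fin t → S) :=
  (Matrix.toLinAlgEquiv' : Matrix (Fin t) (Fin t) S ≃ₐ[S] _).toMonoidHom.comp A

theorem matRep_apply {S : Type*} [CommRing S] (A : H →* Matrix (Fin t) (Fin t) S) (h : H)
    (v : Fin t → S) : matRep A h v = (A h).mulVec v := by
  simp [matRep]

variable {ℓ : ℕ} [Fact ℓ.Prime]

theorem castHom_toZModPow (x : ℤ_[ℓ]) :
    ZMod.castHom (dvd_pow_self ℓ two_ne_zero) (ZMod ℓ) (PadicInt.toZModPow 2 x) =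
      PadicInt.toZMod x := by
  obtain ⟨y, hy⟩ := dvd_of_toZMod_eq_zero (x := x - ((PadicInt.toZMod x).val : ℤ_[ℓ]))
    (by rw [map_sub, map_natCast, ZMod.natCast_zmod_val, sub_self])
  rw [sub_eq_iff_eq_add.1 hy]
  simp

theorem toZModPow_surjective (n : ℕ) :
    Function.Surjective (PadicInt.toZModPow n : ℤ_[ℓ] →+* ZMod (ℓ ^ n)) := fun x => by
  obtain ⟨k, rfl⟩ := ZMod.natCast_zmod_surjective x
  exact ⟨k, map_natCast _ k⟩

/-- The fibres are closed balls of radius `ℓ ^ (-n)`, which are open in an ultrametric space. -/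
theorem isLocallyConstant_toZModPow (n : ℕ) :
    IsLocallyConstant (PadicInt.toZModPow n : ℤ_[ℓ] →+* ZMod (ℓ ^ n)) := by
  refine IsLocallyConstant.iff_isOpen_fiber.2 fun y => ?_
  obtain ⟨x₀, rfl⟩ := toZModPow_surjective n y
  have h0 : (ℓ : ℝ) ^ (-n : ℤ) ≠ 0 :=
    zpow_ne_zero _ (by exact_mod_cast (Fact.out : ℓ.Prime).ne_zero)
  have : (PadicInt.toZModPow n : ℤ_[ℓ] →+* ZMod (ℓ ^ n)) ⁻¹' {PadicInt.toZModPow n x₀} =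
      Metric.closedBall x₀ ((ℓ : ℝ) ^ (-n : ℤ)) := by
    ext x
    rw [Set.mem_preimage, Set.mem_singleton_iff, Metric.mem_closedBall, dist_eq_norm,
      PadicInt.norm_le_pow_iff_mem_span_pow, ← PadicInt.ker_toZModPow, RingHom.mem_ker, map_sub,
      sub_eq_zero]
  rw [this]
  exact IsUltrametricDist.isOpen_closedBall x₀ h0

theorem isLocallyConstant_toZMod : IsLocallyConstant (PadicInt.toZMod : ℤ_[ℓ] →+* ZMod ℓ) := by
  have : (PadicInt.toZMod : ℤ_[ℓ] → ZMod ℓ) =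
      ZMod.castHom (dvd_pow_self ℓ two_ne_zero) (ZMod ℓ) ∘ PadicInt.toZModPow 2 :=
    funext fun x => (castHom_toZModPow x).symm
  rw [this]
  exact (isLocallyConstant_toZModPow 2).comp _

/-- Reduction modulo `ℓ ^ 2` of a representation over `ℤ_ℓ`. -/
noncomputable def redSq (A : H →* Matrix (Fin t) (Fin t) ℤ_[ℓ]) :
    H →* Matrix (Fin t) (Fin t) (ZMod (ℓ ^ 2)) :=
  ((PadicInt.toZModPow 2).mapMatrix : Matrix (Fin t) (Fin t) ℤ_[ℓ] →+*
    Matrix (Fin t) (Fin t) (ZMod (ℓ ^ 2))).toMonoidHom.comp A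

theorem redSq_mulVec (A : H →* Matrix (Fin t) (Fin t) ℤ_[ℓ]) (h : H) (v : Fin t → ℤ_[ℓ]) :
    (redSq A h).mulVec (PadicInt.toZModPow 2 ∘ v) = PadicInt.toZModPow 2 ∘ (A h).mulVec v :=
  funext fun i => (RingHom.map_mulVec (PadicInt.toZModPow 2) (A h) v i).symm

theorem redHom_apply (v : Fin t → ℤ_[ℓ]) :
    redHom ℓ t (Multiplicative.ofAdd (PadicInt.toZModPow 2 ∘ v)) =
      Multiplicative.ofAdd (PadicInt.toZMod ∘ v) :=
  congrArg Multiplicative.ofAdd (funext fun i => castHom_toZModPow (v i))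

theorem toZMod_comp_mulVec {A : H →* Matrix (Fin t) (Fin t) ℤ_[ℓ]}
    {M : H →* Matrix (Fin t) (Fin t) (ZMod ℓ)} (hA : ∀ h, (A h).map PadicInt.toZMod = M h) (h : H)
    (v : Fin t → ℤ_[ℓ]) :
    PadicInt.toZMod ∘ (A h).mulVec v = (M h).mulVec (PadicInt.toZMod ∘ v) := by
  rw [← hA]
  exact funext fun i => RingHom.map_mulVec PadicInt.toZMod (A h) v i

theorem exists_toZModPow_comp_eq (n : ℕ) (v : Fin t → ZMod (ℓ ^ n)) :
    ∃ w : Fin t → ℤ_[ℓ], PadicInt.toZModPow n ∘ w = v := by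
  choose w hw using fun i => toZModPow_surjective n (v i)
  exact ⟨w, funext hw⟩

theorem exists_toZMod_comp_eq (v : Fin t → ZMod ℓ) :
    ∃ w : Fin t → ℤ_[ℓ], PadicInt.toZMod ∘ w = v := by
  choose w hw using fun i => toZMod_surjective (v i)
  exact ⟨w, funext hw⟩

theorem redHom_matAut {A : H →* Matrix (Fin t) (Fin t) ℤ_[ℓ]}
    {M : H →* Matrix (Fin t) (Fin t) (ZMod ℓ)} (hA : ∀ h, (A h).map PadicInt.toZMod = M h) (h : H)
    (v : ZPow (ℓ ^ 2) t) :
    redHom ℓ t (matAut (redSq A) h v) = matAut M h (redHom ℓ t v) := by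
  obtain ⟨w, hw⟩ := exists_toZModPow_comp_eq 2 (Multiplicative.toAdd v)
  obtain rfl : Multiplicative.ofAdd (PadicInt.toZModPow 2 ∘ w) = v := hw
  have h1 : matAut (redSq A) h (Multiplicative.ofAdd (PadicInt.toZModPow 2 ∘ w)) =
      Multiplicative.ofAdd (PadicInt.toZModPow 2 ∘ (A h).mulVec w) :=
    congrArg Multiplicative.ofAdd (redSq_mulVec A h w)
  rw [h1, redHom_apply, redHom_apply, toZMod_comp_mulVec hA]
  rfl

/-- Reduction modulo `ℓ` is a Frattini cover. -/
theorem isFrattiniCover_redMap {φ₂ : H →* MulAut (ZPow (ℓ ^ 2) t)} {φ₁ : H →* MulAut (ZPow ℓ t)}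
    (h : ∀ g v, redHom ℓ t (φ₂ g v) = φ₁ g (redHom ℓ t v)) : IsFrattiniCover (redMap h) := by
  refine ⟨(redSection h).surj, fun K hK => ?_⟩
  have hlift : ∀ y, ∃ x ∈ K, redMap h x = y := fun y => by
    have : y ∈ K.map (redMap h) := by
      rw [hK]
      trivial
    exact this
  -- In additive notation `v = w + ℓ u` with `w` in `K`. Applying this to `u` as well leaves an
  -- error `ℓ² u'`, which is zero.
  have happrox : ∀ v : ZPow (ℓ ^ 2) t, ∃ w u, SemidirectProduct.inl w ∈ K ∧ v = w * u ^ ℓ := by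
    intro v
    obtain ⟨x, hx, hxv⟩ := hlift (SemidirectProduct.inl (redHom ℓ t v))
    have h1 : redHom ℓ t x.left = redHom ℓ t v := congrArg SemidirectProduct.left hxv
    have h2 : x.right = 1 := congrArg SemidirectProduct.right hxv
    have hx' : x = SemidirectProduct.inl x.left := by
      ext1
      · rfl
      · exact h2
    have h3 : redHom ℓ t (v / x.left) = 1 := by rw [map_div, h1, div_self']
    obtain ⟨w, hw⟩ := exists_toZModPow_comp_eq 2 (Multiplicative.toAdd (v / x.left))
    obtain hw : Multiplicative.ofAdd (PadicInt.toZModPow 2 ∘ w) = v / x.left := hw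
    rw [← hw, redHom_apply] at h3
    choose u hu using fun i => dvd_of_toZMod_eq_zero (congrFun h3 i)
    refine ⟨x.left, Multiplicative.ofAdd (PadicInt.toZModPow 2 ∘ u), hx' ▸ hx, ?_⟩
    rw [← mul_div_cancel x.left v, ← hw]
    congr 1
    refine congrArg Multiplicative.ofAdd (funext fun i => ?_)
    change PadicInt.toZModPow 2 (w i) = ℓ • PadicInt.toZModPow 2 (u i)
    rw [hu i, map_mul, map_natCast, nsmul_eq_mul]
  have hinl : ∀ v : ZPow (ℓ ^ 2) t, SemidirectProduct.inl v ∈ K := by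
    intro v
    obtain ⟨w, u, hw, rfl⟩ := happrox v
    obtain ⟨w', u', hw', rfl⟩ := happrox u
    have : (u' ^ ℓ) ^ ℓ = 1 := by
      rw [← pow_mul, ← pow_two]
      refine congrArg Multiplicative.ofAdd (funext fun i => ?_)
      change (ℓ ^ 2) • (Multiplicative.toAdd u' i) = 0
      rw [nsmul_eq_mul, ZMod.natCast_self, zero_mul]
    rw [mul_pow, this, mul_one, map_mul, map_pow]
    exact mul_mem hw (pow_mem hw' ℓ)
  refine eq_top_iff.2 fun x _ => ?_
  obtain ⟨y, hy, hyx⟩ := hlift (SemidirectProduct.inr x.right)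
  have h1 : y.right = x.right := by
    change (redMap h y).right = x.right
    rw [hyx]
    rfl
  have : x = SemidirectProduct.inl (x.left * y.left⁻¹) * y := by
    ext1
    · simp
    · simp [h1]
  rw [this]
  exact mul_mem (hinl _) hy

/-- The kernel of reduction modulo `ℓ` is the representation it reduces to. -/
theorem exists_redSection_equiv {A : H →* Matrix (Fin t) (Fin t) ℤ_[ℓ]}
    {M : H →* Matrix (Fin t) (Fin t) (ZMod ℓ)} (hA : ∀ h, (A h).map PadicInt.toZMod = M h) :
    Nonempty (Representation.Equiv (sectionRep (redSection (redHom_matAut hA)))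
      ((matRep M).comp SemidirectProduct.rightHom : Representation (ZMod ℓ) _ _)) := by
  let K := (redMap (redHom_matAut hA)).ker
  have hw : ∀ x : K, ∃ w : Fin t → ℤ_[ℓ],
      x.1 = SemidirectProduct.inl (Multiplicative.ofAdd (PadicInt.toZModPow 2 ∘ (ℓ • w))) := by
    intro x
    obtain ⟨v, hv, hx⟩ := redMap_ker _ x.2
    obtain ⟨w, hw⟩ := exists_toZModPow_comp_eq 2 (Multiplicative.toAdd v)
    obtain rfl : Multiplicative.ofAdd (PadicInt.toZModPow 2 ∘ w) = v := hw
    rw [redHom_apply] at hv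
    choose u hu using fun i => dvd_of_toZMod_eq_zero (congrFun hv i)
    refine ⟨u, ?_⟩
    have : w = ℓ • u := funext fun i => by rw [hu i, Pi.smul_apply, nsmul_eq_mul]
    rw [hx, this]
  -- The kernel of reduction is `ℓ (ℤ/ℓ²)^t`; division by `ℓ` is well defined mod `ℓ` and gives the
  -- isomorphism with `(ℤ/ℓ)^t`.
  have huniq : ∀ w w' : Fin t → ℤ_[ℓ],
      PadicInt.toZModPow 2 ∘ (ℓ • w) = PadicInt.toZModPow 2 ∘ (ℓ • w') →
        PadicInt.toZMod ∘ w = PadicInt.toZMod ∘ w' := by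
    intro w w' h
    funext i
    have h1 : PadicInt.toZModPow 2 (ℓ • w i - ℓ • w' i) = 0 := by
      rw [map_sub, sub_eq_zero]
      exact congrFun h i
    rw [← RingHom.mem_ker, PadicInt.ker_toZModPow, Ideal.mem_span_singleton] at h1
    obtain ⟨z, hz⟩ := h1
    have h2 : w i - w' i = ℓ * z := by
      rw [nsmul_eq_mul, nsmul_eq_mul, ← mul_sub, pow_two, mul_assoc] at hz
      exact mul_left_cancel₀ (by exact_mod_cast (Fact.out : ℓ.Prime).ne_zero) hz
    change PadicInt.toZMod (w i) = PadicInt.toZMod (w' i)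
    rw [sub_eq_iff_eq_add.1 h2]
    simp
  choose f hf using hw
  have hfu : ∀ (x : K) (w : Fin t → ℤ_[ℓ]),
      x.1 = SemidirectProduct.inl (Multiplicative.ofAdd (PadicInt.toZModPow 2 ∘ (ℓ • w))) →
        PadicInt.toZMod ∘ f x = PadicInt.toZMod ∘ w := by
    intro x w h
    rw [hf x, SemidirectProduct.inl_inj] at h
    exact huniq _ _ h
  let F : K →* Multiplicative (Fin t → ZMod ℓ) :=
    { toFun := fun x => Multiplicative.ofAdd (PadicInt.toZMod ∘ f x)
      map_one' := by
        rw [hfu 1 0]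
        · refine congrArg Multiplicative.ofAdd (funext fun i => ?_)
          simp
        · rw [Subgroup.coe_one, ← map_one SemidirectProduct.inl]
          congr 1
          refine congrArg Multiplicative.ofAdd (funext fun i => ?_)
          simp
      map_mul' := fun x y => by
        rw [hfu (x * y) (f x + f y)]
        · refine congrArg Multiplicative.ofAdd (funext fun i => ?_)
          simp
        · rw [Subgroup.coe_mul, hf x, hf y, ← map_mul]
          congr 1
          refine congrArg Multiplicative.ofAdd (funext fun i => ?_)
          simp }
  refine (exists_equiv_of_section (redSection (redHom_matAut hA))
    ((matRep M).comp SemidirectProduct.rightHom : Representation (ZMod ℓ) _ _) F ?_ ?_ ?_).elim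
    fun e _ => ⟨e⟩
  · intro v
    obtain ⟨w, hw⟩ := exists_toZMod_comp_eq (Multiplicative.toAdd v)
    refine ⟨⟨SemidirectProduct.inl (Multiplicative.ofAdd (PadicInt.toZModPow 2 ∘ (ℓ • w))), ?_⟩, ?_⟩
    · rw [MonoidHom.mem_ker]
      ext1
      · change redHom ℓ t _ = 1
        rw [SemidirectProduct.left_inl, redHom_apply]
        refine congrArg Multiplicative.ofAdd (funext fun i => ?_)
        simp
      · rfl
    · exact congrArg Multiplicative.ofAdd ((hfu _ w rfl).trans hw)
  · intro x
    rw [Subgroup.mem_bot]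
    constructor
    · intro h
      choose u hu using fun i => dvd_of_toZMod_eq_zero (congrFun h i)
      rw [hf x, ← map_one (SemidirectProduct.inl)]
      congr 1
      refine congrArg Multiplicative.ofAdd (funext fun i => ?_)
      have h1 : ((ℓ ^ 2 : ℕ) : ZMod (ℓ ^ 2)) = 0 := ZMod.natCast_self _
      push_cast at h1
      simp [hu i, ← mul_assoc, ← pow_two, h1]
    · intro h
      have : x = 1 := Subtype.ext h
      rw [this, map_one]
  · intro a x
    change PadicInt.toZMod ∘ f _ = matRep M a.right (PadicInt.toZMod ∘ f x)
    rw [matRep_apply, ← toZMod_comp_mulVec hA]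
    refine hfu _ _ ?_
    change a * x.1 * a⁻¹ = _
    rw [hf x, conj_inl]
    congr 1
    refine congrArg Multiplicative.ofAdd ((redSq_mulVec A a.right (ℓ • f x)).trans ?_)
    rw [Matrix.mulVec_smul]

end MatrixActions

/-! ### The canonical map `π` -/

section CanonicalMap

variable {ℓ t : ℕ} {G : Type u} [Group G] [TopologicalSpace G] [DiscreteTopology G]

/-- The canonical map `N ⋊ H → N / fr(N) ⋊ H`. -/
theorem exists_isFrattiniQuotientMap {N H : Subgroup G} [N.Normal] {s : G →* H} (hker : s.ker = N)
    (hs : ∀ h : H, s h = h) {q : N →* ZPow ℓ t} (hq : Function.Surjective q)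
    (hqker : ∀ n : N, q n = 1 ↔ (n : G) ∈ frattiniSubgroup ℓ N)
    {M : H →* Matrix (Fin t) (Fin t) (ZMod ℓ)}
    (hM : ∀ (h : H) (n : N), Multiplicative.toAdd (q ⟨h * n * (h : G)⁻¹,
      Subgroup.Normal.conj_mem inferInstance _ n.2 _⟩) =
        (M h).mulVec (Multiplicative.toAdd (q n))) :
    ∃ π : G →* ZPow ℓ t ⋊[matAut M] H, IsFrattiniQuotientMap N H π ∧
      (∀ g, (π g).right = s g) ∧ ∀ n : N, (π n).left = q n := by
  -- This is the `N`-component of `g`; `π` sends `g` to its image under `q` paired with `s g`.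
  have hmem : ∀ g : G, g * ((s g : H) : G)⁻¹ ∈ N := fun g => by
    rw [← hker, MonoidHom.mem_ker, map_mul, map_inv, hs, mul_inv_cancel]
  have hsN : ∀ n ∈ N, s n = 1 := fun n hn => by rwa [← hker] at hn
  let π : G →* ZPow ℓ t ⋊[matAut M] H :=
    { toFun := fun g => ⟨q ⟨_, hmem g⟩, s g⟩
      map_one' := by
        ext1
        · change q _ = 1
          rw [← map_one q]
          congr 1
          ext
          simp
        · exact map_one s
      map_mul' := fun g g' => by
        ext1
        · rw [SemidirectProduct.mul_left]
          have h1 : matAut M (s g) (q ⟨_, hmem g'⟩) = q ⟨_, _⟩ :=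
            (congrArg Multiplicative.ofAdd (hM (s g) ⟨_, hmem g'⟩)).symm
          change q _ = q ⟨_, hmem g⟩ * matAut M (s g) (q ⟨_, hmem g'⟩)
          rw [h1, ← map_mul]
          congr 1
          ext
          simp [mul_assoc]
        · exact map_mul s g g' }
  have hleft : ∀ n : N, (π n).left = q n := fun n => by
    change q _ = q n
    congr 1
    ext
    simp [hsN n n.2]
  have hle : frattiniSubgroup ℓ N ≤ N := by
    refine Subgroup.topologicalClosure_minimal _ ((Subgroup.closure_le _).2 ?_)
      (isClosed_discrete _)
    rintro _ (⟨x, hx, rfl⟩ | ⟨x, hx, y, hy, rfl⟩)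
    · exact pow_mem hx ℓ
    · exact mul_mem (mul_mem (mul_mem hx hy) (inv_mem hx)) (inv_mem hy)
  have hH : ∀ h : H, π h = SemidirectProduct.inr h := fun h => by
    ext1
    · change q _ = 1
      rw [← map_one q]
      congr 1
      ext
      simp [hs]
    · exact hs h
  refine ⟨π, ⟨fun x => ?_, ?_, hsN, hH⟩, fun g => rfl, hleft⟩
  · obtain ⟨n, hn⟩ := hq x.left
    refine ⟨n * x.right, ?_⟩
    rw [map_mul, hH]
    ext1
    · simp [hleft, hn]
    · change (s n * x.right) = x.right
      rw [hsN n n.2, one_mul]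
  · ext g
    constructor
    · intro hg
      have h1 : s g = 1 := congrArg SemidirectProduct.right (MonoidHom.mem_ker.1 hg)
      have hgN : g ∈ N := by rwa [← hker]
      have h2 := congrArg SemidirectProduct.left (MonoidHom.mem_ker.1 hg)
      exact (hqker ⟨g, hgN⟩).1 ((hleft ⟨g, hgN⟩).symm.trans h2)
    · intro hg
      rw [MonoidHom.mem_ker]
      ext1
      · exact (hleft ⟨g, hle hg⟩).trans ((hqker ⟨g, hle hg⟩).2 hg)
      · exact hsN g (hle hg)

end CanonicalMap

/-! ### Topology on semidirect products -/

section SemidirectTopology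

variable {N : Type*} {G : Type*} [Group N] [Group G] [TopologicalSpace N] [TopologicalSpace G]
  {φ : G →* MulAut N}

/-- The product topology on a semidirect product. -/
instance : TopologicalSpace (N ⋊[φ] G) :=
  TopologicalSpace.induced SemidirectProduct.equivProd inferInstance

/-- A semidirect product is homeomorphic to the product. -/
def semidirectHomeomorph : (N ⋊[φ] G) ≃ₜ N × G :=
  SemidirectProduct.equivProd.toHomeomorphOfIsInducing ⟨rfl⟩

theorem continuous_left : Continuous fun x : N ⋊[φ] G => x.left :=
  continuous_fst.comp (semidirectHomeomorph (φ := φ)).continuous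

theorem continuous_right : Continuous fun x : N ⋊[φ] G => x.right :=
  continuous_snd.comp (semidirectHomeomorph (φ := φ)).continuous

theorem continuous_mk {X : Type*} [TopologicalSpace X] {f : X → N} {g : X → G} (hf : Continuous f)
    (hg : Continuous g) : Continuous fun x => (⟨f x, g x⟩ : N ⋊[φ] G) :=
  (semidirectHomeomorph (φ := φ)).symm.continuous.comp (hf.prodMk hg)

theorem semidirect_isTopologicalGroup [IsTopologicalGroup N] [IsTopologicalGroup G]
    (h : Continuous fun x : G × N => φ x.1 x.2) : IsTopologicalGroup (N ⋊[φ] G) where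
  continuous_mul := continuous_mk
    ((continuous_left.comp continuous_fst).mul (h.comp
      ((continuous_right.comp continuous_fst).prodMk (continuous_left.comp continuous_snd))))
    ((continuous_right.comp continuous_fst).mul (continuous_right.comp continuous_snd))
  continuous_inv := continuous_mk
    (h.comp (continuous_right.inv.prodMk continuous_left.inv)) continuous_right.inv

end SemidirectTopology

/-! ### Construction of the lattice cover `G⋆ → G` -/

section LatticeCover

variable {ℓ t : ℕ} [Fact ℓ.Prime] {G : Type u} [Group G] [TopologicalSpace G]
  {H : Type*} [Group H]

/-- The extension `E` of `G` embeds into `ℤ_ℓ ^ t ⋊ G`, where `G` acts through `A ∘ s`; the crossed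
homomorphism `c` is the first coordinate. -/
structure IsLatticeCover (A : H →* Matrix (Fin t) (Fin t) ℤ_[ℓ]) (s : G →* H) {E : ProfiniteGrp.{u}}
    (ψ : E →ₜ* G) (c : E → Fin t → ℤ_[ℓ]) : Prop where
  continuous_coord : Continuous c
  crossed : ∀ x y, c (x * y) = c x + (A (s (ψ x))).mulVec (c y)
  ext : ∀ x y, ψ x = ψ y → c x = c y → x = y

theorem tendsto_pow_nsmul (v : Fin t → ℤ_[ℓ]) :
    Tendsto (fun k : ℕ => ℓ ^ k • v) atTop (𝓝 0) := by
  refine tendsto_pi_nhds.2 fun i => ?_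
  have h : Tendsto (fun k : ℕ => (ℓ : ℤ_[ℓ]) ^ k * v i) atTop (𝓝 (0 * v i)) :=
    (tendsto_pow_atTop_nhds_zero_of_norm_lt_one (by
      rw [PadicInt.norm_p]
      exact inv_lt_one_of_one_lt₀ (by exact_mod_cast (Fact.out : ℓ.Prime).one_lt))).mul_const _
  rw [zero_mul] at h
  refine h.congr fun k => ?_
  rw [Pi.smul_apply, nsmul_eq_mul, Nat.cast_pow]

/-- There is an `ℓ`-Frattini cover of `G` inside the fibre product of `ℤ_ℓ ^ t ⋊ H` and `G`
over `(ℤ/ℓ)^t ⋊ H`. -/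
theorem exists_isLatticeCover [Finite G] [DiscreteTopology G]
    {A : H →* Matrix (Fin t) (Fin t) ℤ_[ℓ]}
    {M : H →* Matrix (Fin t) (Fin t) (ZMod ℓ)} (hA : ∀ h, (A h).map PadicInt.toZMod = M h)
    {s : G →* H} (π : G →* ZPow ℓ t ⋊[matAut M] H) (hπ : ∀ g, (π g).right = s g) :
    ∃ (E : ProfiniteGrp.{u}) (ψ : E →ₜ* G) (c : E → Fin t → ℤ_[ℓ]), IsLFrattiniCover ℓ ψ ∧
      IsLatticeCover A s ψ c ∧
      ∀ x, Multiplicative.ofAdd (PadicInt.toZMod ∘ c x) = (π (ψ x)).left := by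
  let X := Multiplicative (Fin t → ℤ_[ℓ])
  let φ : G →* MulAut X := (matAut A).comp s
  have : IsTopologicalGroup (X ⋊[φ] G) := by
    refine semidirect_isTopologicalGroup ?_
    refine continuous_prod_of_discrete_left.2 fun g => ?_
    exact (Matrix.mulVecLin (A (s g))).continuous_on_pi
  have : CompactSpace X := inferInstanceAs (CompactSpace (Fin t → ℤ_[ℓ]))
  have : CompactSpace (X ⋊[φ] G) := semidirectHomeomorph.symm.compactSpace
  have : TotallyDisconnectedSpace X := inferInstanceAs (TotallyDisconnectedSpace (Fin t → ℤ_[ℓ]))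
  have : TotallyDisconnectedSpace (X ⋊[φ] G) := semidirectHomeomorph.symm.totallyDisconnectedSpace
  have : T2Space (X ⋊[φ] G) := semidirectHomeomorph.symm.t2Space
  let redX : X →* ZPow ℓ t := AddMonoidHom.toMultiplicative
    (AddMonoidHom.pi fun i => PadicInt.toZMod.toAddMonoidHom.comp (Pi.evalAddMonoidHom _ i))
  have hredX : ∀ g, redX.comp (φ g).toMonoidHom = (matAut M (s g)).toMonoidHom.comp redX := fun g =>
    MonoidHom.ext fun v => congrArg Multiplicative.ofAdd
      (toZMod_comp_mulVec hA (s g) (Multiplicative.toAdd v))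
  -- The fibre product, realized inside `ℤ_ℓ^t ⋊ G`: the `H`-component of a point is determined by
  -- its image in `G`, so membership is a congruence mod `ℓ` on the first coordinate.
  let B : Subgroup (X ⋊[φ] G) := (SemidirectProduct.map redX s hredX).eqLocus
    (π.comp SemidirectProduct.rightHom)
  have hmem : ∀ x, x ∈ B ↔ redX x.left = (π x.right).left := fun x => by
    refine ⟨fun h => congrArg SemidirectProduct.left h, fun h => ?_⟩
    change SemidirectProduct.map redX s hredX x = π x.right
    ext1
    · exact h
    · exact (hπ x.right).symm
  have hB : IsClosed (B : Set (X ⋊[φ] G)) := by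
    let c : X ⋊[φ] G → Fin t → ℤ_[ℓ] := fun x => Multiplicative.toAdd x.left
    let d : G → Fin t → ZMod ℓ := fun g => Multiplicative.toAdd (π g).left
    have : (B : Set (X ⋊[φ] G)) = ⋂ i, {x | PadicInt.toZMod (c x i) - d x.right i = 0} := by
      ext x
      rw [SetLike.mem_coe, hmem, Set.mem_iInter]
      refine ⟨fun h i => sub_eq_zero.2 (congrFun (congrArg Multiplicative.toAdd h) i), fun h =>
        congrArg Multiplicative.ofAdd (funext fun i => sub_eq_zero.1 (h i))⟩
    rw [this]
    refine isClosed_iInter fun i => IsLocallyConstant.isClosed_fiber ?_ 0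
    refine IsLocallyConstant.sub (isLocallyConstant_toZMod.comp_continuous ?_) ?_
    · exact (continuous_apply i).comp (continuous_left (φ := φ))
    · exact (IsLocallyConstant.of_discrete fun g => d g i).comp_continuous
        (continuous_right (φ := φ))
  have : CompactSpace B := isCompact_iff_compactSpace.1 hB.isCompact
  let p : B →ₜ* G := restrictHom B ⟨SemidirectProduct.rightHom, continuous_right⟩
  -- An element of `B` over `1` lies in `ℤ_ℓ^t`, where `ℓ^k v → 0`; so the kernel meets the
  -- convergence condition.
  obtain ⟨K, hK, hcov⟩ := exists_closed_isLFrattiniCover ℓ p (by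
    intro g
    obtain ⟨w, hw⟩ := exists_toZMod_comp_eq (Multiplicative.toAdd (π g).left)
    exact ⟨⟨⟨Multiplicative.ofAdd w, g⟩, (hmem _).2 (congrArg Multiplicative.ofAdd hw)⟩, rfl⟩) (by
    rintro ⟨x, hx⟩ (h1 : x.right = 1)
    refine tendsto_subtype_rng.2 ?_
    have hx' : x = SemidirectProduct.inl x.left := by
      ext1
      · rfl
      · exact h1
    have hcont : Continuous (SemidirectProduct.inl : X →* X ⋊[φ] G) :=
      continuous_mk continuous_id continuous_const
    have h2 : Tendsto (fun k : ℕ => (SemidirectProduct.inl (x.left ^ ℓ ^ k) : X ⋊[φ] G)) atTop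
        (𝓝 (SemidirectProduct.inl 1)) :=
      (hcont.tendsto 1).comp (tendsto_pow_nsmul (Multiplicative.toAdd x.left))
    refine h2.congr fun k => ?_
    rw [map_pow, ← hx']
    rfl)
  have : CompactSpace K := isCompact_iff_compactSpace.1 hK.isCompact
  refine ⟨ProfiniteGrp.of K, restrictHom K p, fun x => Multiplicative.toAdd x.1.1.left, hcov,
    ⟨?_, fun x y => rfl, ?_⟩, fun x => (hmem _).1 x.1.2⟩
  · exact (continuous_left (φ := φ)).comp (continuous_subtype_val.comp continuous_subtype_val)
  · intro x y h1 h2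
    refine Subtype.ext (Subtype.ext ?_)
    ext1
    · exact h2
    · exact h1

end LatticeCover

/-- A closed subgroup of `ℤ_ℓ ^ t` that surjects onto `(ℤ/ℓ)^t` is everything. -/
theorem eq_top_of_surjective_mod {ℓ t : ℕ} [Fact ℓ.Prime]
    {W : AddSubgroup (Fin t → ℤ_[ℓ])}
    (hW : IsClosed (W : Set (Fin t → ℤ_[ℓ])))
    (hred : ∀ v : Fin t → ZMod ℓ, ∃ w ∈ W, PadicInt.toZMod ∘ w = v) : W = ⊤ := by
  have hstep : ∀ v : Fin t → ℤ_[ℓ], ∃ w ∈ W, ∃ u, v = w + ℓ • u := by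
    intro v
    obtain ⟨w, hw, hwv⟩ := hred (PadicInt.toZMod ∘ v)
    choose u hu using fun i => dvd_of_toZMod_eq_zero (x := v i - w i)
      (by rw [map_sub, sub_eq_zero]; exact (congrFun hwv i).symm)
    refine ⟨w, hw, u, funext fun i => ?_⟩
    rw [Pi.add_apply, Pi.smul_apply, nsmul_eq_mul, ← hu i]
    abel
  -- Successive approximation: `v` is a limit of elements of the closed subgroup `W`.
  have happrox : ∀ (k : ℕ) (v : Fin t → ℤ_[ℓ]), ∃ w ∈ W, ∃ u, v = w + ℓ ^ k • u := by
    intro k v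
    induction k with
    | zero => exact ⟨0, zero_mem _, v, by simp⟩
    | succ k ih =>
      obtain ⟨w, hw, u, hu⟩ := ih
      obtain ⟨w', hw', u', hu'⟩ := hstep u
      refine ⟨w + ℓ ^ k • w', add_mem hw (nsmul_mem hw' _), u', ?_⟩
      rw [hu, hu', smul_add, ← mul_smul, ← pow_succ, add_assoc]
  refine eq_top_iff.2 fun v _ => ?_
  choose w hw u hu using fun k => happrox k v
  refine hW.mem_of_tendsto (f := w) (b := atTop) ?_ (Eventually.of_forall hw)
  refine tendsto_pi_nhds.2 fun i => ?_
  have h0 : Tendsto (fun k : ℕ => (ℓ : ℝ)⁻¹ ^ k) atTop (𝓝 0) :=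
    tendsto_pow_atTop_nhds_zero_of_lt_one (by positivity)
      (inv_lt_one_of_one_lt₀ (by exact_mod_cast (Fact.out : ℓ.Prime).one_lt))
  refine tendsto_iff_norm_sub_tendsto_zero.2
    (squeeze_zero (fun _ => norm_nonneg _) (fun k => ?_) h0)
  have : w k i - v i = -((ℓ : ℤ_[ℓ]) ^ k * u k i) := by
    conv_lhs => rw [hu k]
    rw [Pi.add_apply, Pi.smul_apply, nsmul_eq_mul, Nat.cast_pow]
    ring
  rw [this, norm_neg, norm_mul, norm_pow, PadicInt.norm_p]
  exact mul_le_of_le_one_right (by positivity) (PadicInt.norm_le_one _)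

/-! ### The kernel of a lattice cover -/

namespace IsLatticeCover

variable {ℓ t : ℕ} [Fact ℓ.Prime] {G : Type u} [Group G] [TopologicalSpace G]
  {H : Type*} [Group H] {A : H →* Matrix (Fin t) (Fin t) ℤ_[ℓ]} {s : G →* H}
  {E : ProfiniteGrp.{u}} {ψ : E →ₜ* G} {c : E → Fin t → ℤ_[ℓ]}

theorem coord_mul (h : IsLatticeCover A s ψ c) {x : E} (hx : s (ψ x) = 1) (y : E) :
    c (x * y) = c x + c y := by
  rw [h.crossed, hx, map_one, Matrix.one_mulVec]

theorem coord_one (h : IsLatticeCover A s ψ c) : c 1 = 0 := by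
  have h1 := h.coord_mul (x := 1) (by rw [map_one, map_one]) 1
  rw [one_mul] at h1
  exact left_eq_add.1 h1

theorem coord_inv (h : IsLatticeCover A s ψ c) {x : E} (hx : s (ψ x) = 1) : c x⁻¹ = -c x := by
  have h1 := h.coord_mul hx x⁻¹
  rw [mul_inv_cancel, h.coord_one] at h1
  exact (neg_eq_of_add_eq_zero_right h1.symm).symm

theorem coord_pow (h : IsLatticeCover A s ψ c) {x : E} (hx : s (ψ x) = 1) (n : ℕ) :
    c (x ^ n) = n • c x := by
  induction n with
  | zero => rw [pow_zero, h.coord_one, zero_smul]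
  | succ n ih => rw [pow_succ', h.coord_mul hx, ih, succ_nsmul']

/-- Expand `c (y x)` in two ways, the second time as `c ((y x y⁻¹) y)`. -/
theorem coord_conj (h : IsLatticeCover A s ψ c) (y : E) {x : E} (hx : s (ψ x) = 1) :
    c (y * x * y⁻¹) = (A (s (ψ y))).mulVec (c x) := by
  have h1 : s (ψ (y * x * y⁻¹)) = 1 := by simp [hx]
  have h2 := h.coord_mul h1 y
  rw [inv_mul_cancel_right, h.crossed, add_comm] at h2
  exact (add_right_cancel h2).symm

theorem mul_comm_of_ker (h : IsLatticeCover A s ψ c) :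
    ∀ x ∈ ψ.toMonoidHom.ker, ∀ y ∈ ψ.toMonoidHom.ker, x * y = y * x := by
  intro x (hx : ψ x = 1) y (hy : ψ y = 1)
  refine h.ext _ _ (by simp [hx, hy]) ?_
  rw [h.coord_mul (by rw [hx, map_one]), h.coord_mul (by rw [hy, map_one]), add_comm]

/-- The kernel of a lattice cover, as a subgroup of `ℤ_ℓ ^ t`. -/
def lattice (h : IsLatticeCover A s ψ c) : AddSubgroup (Fin t → ℤ_[ℓ]) where
  carrier := {v | ∃ x, ψ x = 1 ∧ c x = v}
  zero_mem' := ⟨1, map_one ψ, h.coord_one⟩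
  add_mem' := by
    rintro _ _ ⟨x, hx, rfl⟩ ⟨y, hy, rfl⟩
    exact ⟨x * y, by rw [map_mul, hx, hy, mul_one], h.coord_mul (by rw [hx, map_one]) y⟩
  neg_mem' := by
    rintro _ ⟨x, hx, rfl⟩
    exact ⟨x⁻¹, by rw [map_inv, hx, inv_one], h.coord_inv (by rw [hx, map_one])⟩

theorem mulVec_mem_lattice (h : IsLatticeCover A s ψ c) (hψ : Function.Surjective ψ)
    (hs : Function.Surjective s) (a : H) {v : Fin t → ℤ_[ℓ]} (hv : v ∈ h.lattice) :
    (A a).mulVec v ∈ h.lattice := by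
  obtain ⟨x, hx, rfl⟩ := hv
  obtain ⟨g, rfl⟩ := hs a
  obtain ⟨y, rfl⟩ := hψ g
  exact ⟨y * x * y⁻¹, by simp [hx], h.coord_conj y (by rw [hx, map_one])⟩

theorem isClosed_image [DiscreteTopology G] (h : IsLatticeCover A s ψ c) (S : Set G) :
    IsClosed (c '' (ψ ⁻¹' S)) :=
  (((isClosed_discrete S).preimage ψ.continuous_toFun).isCompact.image h.continuous_coord).isClosed

theorem isClosed_lattice [DiscreteTopology G] (h : IsLatticeCover A s ψ c) :
    IsClosed (h.lattice : Set (Fin t → ℤ_[ℓ])) := h.isClosed_image {1}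

/-- Over `ker s` the coordinate `c` is additive; its image there is closed and everything mod `ℓ`,
so it is all of `ℤ_ℓ^t`. If `c x = v`, then `x ^ ℓ ^ m` lies in `ker ψ` and has coordinate `ℓ^m v`.
-/
theorem pow_nsmul_mem_lattice [DiscreteTopology G] (h : IsLatticeCover A s ψ c) {m : ℕ}
    (hm : ∀ g, s g = 1 → g ^ ℓ ^ m = 1)
    (hred : ∀ v : Fin t → ZMod ℓ, ∃ x, s (ψ x) = 1 ∧ PadicInt.toZMod ∘ c x = v)
    (v : Fin t → ℤ_[ℓ]) : ℓ ^ m • v ∈ h.lattice := by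
  let W : AddSubgroup (Fin t → ℤ_[ℓ]) :=
    { carrier := c '' (ψ ⁻¹' {g | s g = 1})
      zero_mem' := ⟨1, by simp, h.coord_one⟩
      add_mem' := by
        rintro _ _ ⟨x, hx, rfl⟩ ⟨y, hy, rfl⟩
        refine ⟨x * y, ?_, h.coord_mul hx y⟩
        change s (ψ (x * y)) = 1
        rw [map_mul, map_mul, hx, hy, one_mul]
      neg_mem' := by
        rintro _ ⟨x, hx, rfl⟩
        refine ⟨x⁻¹, ?_, h.coord_inv hx⟩
        change s (ψ x⁻¹) = 1
        rw [map_inv, map_inv, hx, inv_one] }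
  have hW : W = ⊤ := eq_top_of_surjective_mod (h.isClosed_image _) fun v => by
    obtain ⟨x, hx, hxv⟩ := hred v
    exact ⟨c x, ⟨x, hx, rfl⟩, hxv⟩
  have hv : v ∈ W := by
    rw [hW]
    trivial
  obtain ⟨x, hx, rfl⟩ := hv
  exact ⟨x ^ ℓ ^ m, by rw [map_pow]; exact hm _ hx, h.coord_pow hx _⟩

/-- The dictionary, through the injection `c` on the kernel, between powers in the group and
multiples in the lattice. -/
theorem mem_kerPow_iff (h : IsLatticeCover A s ψ c) {n : ℕ} {z : E} :
    z ∈ kerPow ψ.toMonoidHom n ↔ ψ z = 1 ∧ ∃ v ∈ h.lattice, n • v = c z := by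
  constructor
  · intro hz
    obtain ⟨x, hx, rfl⟩ := exists_pow_of_mem_kerPow h.mul_comm_of_ker hz
    have hx' : ψ x = 1 := hx
    exact ⟨by rw [map_pow, hx', one_pow], c x, ⟨x, hx, rfl⟩,
      (h.coord_pow (by rw [hx', map_one]) n).symm⟩
  · rintro ⟨hz, _, ⟨x, hx, rfl⟩, hxz⟩
    refine Subgroup.subset_closure ⟨x, hx, h.ext _ _ (by rw [map_pow, hx, one_pow, hz]) ?_⟩
    rw [h.coord_pow (by rw [hx, map_one]), hxz]

/-- The kernel of a lattice cover is isomorphic to `ℤ_ℓ ^ t`. -/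
theorem nonempty_continuousMulEquiv [DiscreteTopology G] (h : IsLatticeCover A s ψ c) {m : ℕ}
    (hm : ∀ v, ℓ ^ m • v ∈ h.lattice) :
    Nonempty (Multiplicative (Fin t → ℤ_[ℓ]) ≃ₜ* ψ.toMonoidHom.ker) := by
  -- A closed subgroup is stable under `ℤ_ℓ` since `ℕ` is dense there.
  let L : Submodule ℤ_[ℓ] (Fin t → ℤ_[ℓ]) :=
    { h.lattice with
      smul_mem' := by
        intro a v hv
        have hcl : IsClosed {a : ℤ_[ℓ] | a • v ∈ h.lattice} :=
          h.isClosed_lattice.preimage (continuous_id.smul continuous_const)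
        refine PadicInt.denseRange_natCast.induction_on a hcl fun n => ?_
        change ((n : ℕ) : ℤ_[ℓ]) • v ∈ h.lattice
        rw [Nat.cast_smul_eq_nsmul]
        exact nsmul_mem hv n }
  have hL : ∀ v, v ∈ L ↔ v ∈ h.lattice := fun v => Iff.rfl
  have hfr : Module.finrank ℤ_[ℓ] (Fin t → ℤ_[ℓ]) = Module.finrank ℤ_[ℓ] L := by
    refine le_antisymm ?_ ?_
    -- Multiplication by `ℓ^m` embeds `ℤ_ℓ^t` in `L`, which forces full rank.
    · let f : (Fin t → ℤ_[ℓ]) →ₗ[ℤ_[ℓ]] L :=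
        (LinearMap.lsmul ℤ_[ℓ] _ ((ℓ ^ m : ℕ) : ℤ_[ℓ])).codRestrict L fun v => by
          rw [hL, LinearMap.lsmul_apply, Nat.cast_smul_eq_nsmul]
          exact hm v
      refine LinearMap.finrank_le_finrank_of_injective (f := f) fun v w hvw => ?_
      have h1 : ((ℓ ^ m : ℕ) : ℤ_[ℓ]) • v = ((ℓ ^ m : ℕ) : ℤ_[ℓ]) • w := congrArg Subtype.val hvw
      refine smul_right_injective _ ?_ h1
      exact_mod_cast pow_ne_zero m (Fact.out : ℓ.Prime).ne_zero
    · exact LinearMap.finrank_le_finrank_of_injective L.injective_subtype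
  let e : (Fin t → ℤ_[ℓ]) ≃ₗ[ℤ_[ℓ]] L := LinearEquiv.ofFinrankEq _ _ hfr
  have hec : Continuous e :=
    (L.subtype.comp e.toLinearMap).continuous_on_pi.subtype_mk _
  have hec' : Continuous e.symm :=
    (Continuous.homeoOfEquivCompactToT2 (f := e.toEquiv) hec).symm.continuous
  have hker : ∀ x : ψ.toMonoidHom.ker, s (ψ x) = 1 := fun x => by
    rw [show ψ x = 1 from x.2, map_one]
  let f : ψ.toMonoidHom.ker →* Multiplicative (Fin t → ℤ_[ℓ]) := MonoidHom.mk'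
    (fun x => Multiplicative.ofAdd (e.symm ⟨c x, ⟨x, x.2, rfl⟩⟩)) fun x y => by
      rw [← ofAdd_add, ← map_add]
      exact congrArg (fun v : L => Multiplicative.ofAdd (e.symm v))
        (Subtype.ext (h.coord_mul (hker x) y))
  have hfc : Continuous f :=
    hec'.comp ((h.continuous_coord.comp continuous_subtype_val).subtype_mk _)
  have hfb : Function.Bijective f := by
    refine ⟨fun x y hxy => Subtype.ext (h.ext _ _ ?_ ?_), fun v => ?_⟩
    · exact (show ψ x = 1 from x.2).trans (show ψ y = 1 from y.2).symm
    · exact congrArg Subtype.val (e.symm.injective hxy)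
    · obtain ⟨x, hx, hxv⟩ := (e (Multiplicative.toAdd v)).2
      refine ⟨⟨x, hx⟩, congrArg Multiplicative.ofAdd (e.symm_apply_eq.2 (Subtype.ext hxv))⟩
  have hcl : IsClosed (ψ.toMonoidHom.ker : Set E) :=
    (isClosed_discrete {(1 : G)}).preimage ψ.continuous_toFun
  have : CompactSpace ψ.toMonoidHom.ker := isCompact_iff_compactSpace.1 hcl.isCompact
  let e' : ψ.toMonoidHom.ker ≃* Multiplicative (Fin t → ℤ_[ℓ]) := MulEquiv.ofBijective f hfb
  have he' : Continuous e'.symm :=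
    (Continuous.homeoOfEquivCompactToT2 (f := e'.toEquiv) hfc).symm.continuous
  exact ⟨{ e'.symm with
    continuous_toFun := he'
    continuous_invFun := hfc }⟩

/-- The successive quotients `ℓ ^ k L / ℓ ^ (k + 1) L` of the kernel of a lattice cover are all
isomorphic to the reduction of `ℤ_ℓ ^ t`. -/
theorem exists_latticeSection_equiv [Finite H] (hcop : (Nat.card H).Coprime ℓ)
    {M : H →* Matrix (Fin t) (Fin t) (ZMod ℓ)} (hA : ∀ h, (A h).map PadicInt.toZMod = M h)
    (hs : Function.Surjective s) (h : IsLatticeCover A s ψ c) (hψ : Function.Surjective ψ)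
    {m : ℕ} (hm : ∀ v, ℓ ^ m • v ∈ h.lattice) (k : ℕ) :
    Nonempty (Representation.Equiv
      (sectionRep (latticeSection ℓ (p := ψ.toMonoidHom) hψ h.mul_comm_of_ker k))
      ((matRep M).comp s : Representation (ZMod ℓ) G (Fin t → ZMod ℓ))) := by
  let a : H →* AddMonoid.End (Fin t → ℤ_[ℓ]) :=
    { toFun := fun g => (A g).mulVecLin.toAddMonoidHom
      map_one' := by
        ext1 v
        change (A 1).mulVec v = v
        rw [map_one, Matrix.one_mulVec]
      map_mul' := fun g g' => by
        ext1 v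
        change (A (g * g')).mulVec v = (A g).mulVec ((A g').mulVec v)
        rw [map_mul, Matrix.mulVec_mulVec] }
  let b : H →* AddMonoid.End (Fin t → ZMod ℓ) :=
    { toFun := fun g => (M g).mulVecLin.toAddMonoidHom
      map_one' := by
        ext1 v
        change (M 1).mulVec v = v
        rw [map_one, Matrix.one_mulVec]
      map_mul' := fun g g' => by
        ext1 v
        change (M (g * g')).mulVec v = (M g).mulVec ((M g').mulVec v)
        rw [map_mul, Matrix.mulVec_mulVec] }
  let F₀ : (Fin t → ℤ_[ℓ]) →+ (Fin t → ZMod ℓ) :=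
    AddMonoidHom.pi fun i => PadicInt.toZMod.toAddMonoidHom.comp (Pi.evalAddMonoidHom _ i)
  -- This is `ℓ^k L`, a stable sublattice containing `ℓ^(m+k) ℤ_ℓ^t`, so its reduction is that of
  -- `ℤ_ℓ^t`.
  let Y : AddSubgroup (Fin t → ℤ_[ℓ]) := h.lattice.map (nsmulAddMonoidHom (ℓ ^ k))
  have hYa : ∀ g, ∀ y ∈ Y, a g y ∈ Y := by
    rintro g _ ⟨v, hv, rfl⟩
    exact ⟨a g v, h.mulVec_mem_lattice hψ hs g hv, (map_nsmul (a g) (ℓ ^ k) v).symm⟩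
  have hℓ0 : (ℓ : ℤ_[ℓ]) ≠ 0 := by exact_mod_cast (Fact.out : ℓ.Prime).ne_zero
  obtain ⟨F, hFs, hFk, hFa⟩ := exists_reduction (ℓ := ℓ) (a := a) (b := b) (Y := Y) hcop
    (fun x hx => funext fun i => by
      have := congrFun hx i
      rw [Pi.smul_apply, nsmul_eq_mul] at this
      exact (mul_eq_zero.1 this).resolve_left hℓ0)
    (fun v => funext fun i => by
      rw [Pi.smul_apply, nsmul_eq_mul, CharP.cast_eq_zero, zero_mul]
      rfl) F₀
    exists_toZMod_comp_eq
    (fun x => ⟨fun hx => by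
        choose u hu using fun i => dvd_of_toZMod_eq_zero (x := x i) (congrFun hx i)
        exact ⟨u, funext fun i => by rw [hu i, Pi.smul_apply, nsmul_eq_mul]⟩,
      by
        rintro ⟨z, rfl⟩
        refine funext fun i => ?_
        change PadicInt.toZMod (ℓ • z i) = 0
        simp⟩)
    (fun g x => toZMod_comp_mulVec hA g x) (m + k) hYa
    (fun x => ⟨ℓ ^ m • x, hm x, by
      change ℓ ^ k • ℓ ^ m • x = _
      rw [← mul_smul, ← pow_add, add_comm]⟩)
  have hker : ∀ z ∈ kerPow ψ.toMonoidHom (ℓ ^ k), s (ψ z) = 1 := fun z hz => by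
    rw [(h.mem_kerPow_iff.1 hz).1, map_one]
  let Φ : kerPow ψ.toMonoidHom (ℓ ^ k) →* Multiplicative (Fin t → ZMod ℓ) := MonoidHom.mk'
    (fun z => Multiplicative.ofAdd (F ⟨c z, (h.mem_kerPow_iff.1 z.2).2⟩)) fun x y => by
      rw [← ofAdd_add, ← map_add]
      exact congrArg (fun v : Y => Multiplicative.ofAdd (F v))
        (Subtype.ext (h.coord_mul (hker x x.2) y))
  refine (exists_equiv_of_section (latticeSection ℓ (p := ψ.toMonoidHom) hψ h.mul_comm_of_ker k)
    ((matRep M).comp s : Representation (ZMod ℓ) G (Fin t → ZMod ℓ)) Φ ?_ ?_ ?_).elim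
    fun e _ => ⟨e⟩
  · intro v
    obtain ⟨⟨_, ⟨w, ⟨x, hx, rfl⟩, rfl⟩⟩, hv⟩ := hFs (Multiplicative.toAdd v)
    have hx1 : s (ψ x) = 1 := by rw [hx, map_one]
    refine ⟨⟨x ^ ℓ ^ k, Subgroup.subset_closure ⟨x, hx, rfl⟩⟩, ?_⟩
    refine Eq.trans ?_ (congrArg Multiplicative.ofAdd hv)
    exact congrArg (fun v : Y => Multiplicative.ofAdd (F v)) (Subtype.ext (h.coord_pow hx1 _))
  · intro z
    have h1 : Φ z = 1 ↔ F ⟨c z, (h.mem_kerPow_iff.1 z.2).2⟩ = 0 := Iff.rfl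
    rw [h1, hFk]
    refine Iff.trans ?_ h.mem_kerPow_iff.symm
    constructor
    · rintro ⟨_, ⟨w, hw, rfl⟩, hz⟩
      refine ⟨(h.mem_kerPow_iff.1 z.2).1, w, hw, ?_⟩
      rw [pow_succ', mul_smul]
      exact hz
    · rintro ⟨_, w, hw, hz⟩
      refine ⟨ℓ ^ k • w, ⟨w, hw, rfl⟩, ?_⟩
      rw [← mul_smul, ← pow_succ', hz]
  · intro y z
    change F _ = matRep M (s (ψ y)) (F _)
    rw [matRep_apply]
    refine Eq.trans ?_ (hFa (s (ψ y)) ⟨c z, (h.mem_kerPow_iff.1 z.2).2⟩)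
    exact congrArg F (Subtype.ext (h.coord_conj y (hker z z.2)))

end IsLatticeCover

/-! ### Factoring the universal cover through a cover with abelian kernel -/

section Factorization

variable {ℓ : ℕ} {G : Type u} [Group G] [TopologicalSpace G] {E F : ProfiniteGrp.{u}}

/-- A continuous homomorphism to a Frattini cover of `G` over `G` is surjective. -/
theorem IsLFrattiniCover.surjective_of_comp {ψ : E →ₜ* G} (hψ : Function.Surjective ψ)
    {χ : F →ₜ* G} (hχ : IsLFrattiniCover ℓ χ) {θ : E →ₜ* F} (hθ : χ.comp θ = ψ) :
    Function.Surjective θ := by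
  have hcl : IsClosed (θ.toMonoidHom.range : Set F) :=
    (isCompact_range θ.continuous_toFun).isClosed
  refine MonoidHom.range_eq_top.1 (hχ.eq_top θ.toMonoidHom.range hcl (eq_top_iff.2 fun g _ => ?_))
  obtain ⟨x, rfl⟩ := hψ g
  exact ⟨θ x, ⟨x, rfl⟩, DFunLike.congr_fun hθ x⟩

/-- A homomorphism to a cover with abelian kernel factors through the abelianized cover. -/
theorem exists_abCover_factor {ψ : E →ₜ* G} {χ : F →ₜ* G}
    (hc : ∀ x ∈ χ.toMonoidHom.ker, ∀ y ∈ χ.toMonoidHom.ker, x * y = y * x)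
    {θ : E →ₜ* F} (hθ : χ.comp θ = ψ) :
    ∃ ν : AbCover ψ →ₜ* F, ∀ x : E, ν (QuotientGroup.mk x) = θ x := by
  have hker : ∀ x ∈ ψ.toMonoidHom.ker, θ x ∈ χ.toMonoidHom.ker := fun x hx =>
    (DFunLike.congr_fun hθ x).trans hx
  have hle : kerCommutator ψ ≤ θ.toMonoidHom.ker := by
    refine Subgroup.topologicalClosure_minimal _ (Subgroup.commutator_le.2 fun x hx y hy => ?_)
      (isClosed_singleton.preimage θ.continuous_toFun)
    rw [MonoidHom.mem_ker, map_commutatorElement, commutatorElement_eq_one_iff_mul_comm]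
    exact hc _ (hker x hx) _ (hker y hy)
  exact ⟨⟨QuotientGroup.lift (kerCommutator ψ) θ.toMonoidHom hle,
    θ.continuous_toFun.quotient_lift _⟩, fun x => rfl⟩

variable [DiscreteTopology G]

/-- The kernel is abelian, so this is the image of a compact set under a power map. Closedness is
needed because `frattiniSubgroup` is a closure. -/
theorem isClosed_kerPow {χ : F →ₜ* G}
    (hc : ∀ x ∈ χ.toMonoidHom.ker, ∀ y ∈ χ.toMonoidHom.ker, x * y = y * x) (n : ℕ) :
    IsClosed (kerPow χ.toMonoidHom n : Set F) := by
  have hcl : IsClosed (χ.toMonoidHom.ker : Set F) :=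
    (isClosed_discrete {(1 : G)}).preimage χ.continuous_toFun
  have : (kerPow χ.toMonoidHom n : Set F) = (fun x => x ^ n) '' (χ.toMonoidHom.ker : Set F) := by
    ext z
    exact ⟨fun hz => exists_pow_of_mem_kerPow hc hz, fun hz => Subgroup.subset_closure hz⟩
  rw [this]
  exact (hcl.isCompact.image (continuous_pow n)).isClosed

/-- An isomorphism of `L / ℓ L` with a representation, for `L` the abelian kernel of a cover `χ`
dominated by `ψ`, induces a surjection from the characteristic module of `ψ`. -/
theorem exists_charRep_intertwiningMap {ψ : E →ₜ* G} (hψ : Function.Surjective ψ) {χ : F →ₜ* G}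
    (hχ : Function.Surjective χ)
    (hc : ∀ x ∈ χ.toMonoidHom.ker, ∀ y ∈ χ.toMonoidHom.ker, x * y = y * x)
    {θ : E →ₜ* F} (hθ : χ.comp θ = ψ) (hsurj : Function.Surjective θ)
    {V : Type*} [AddCommGroup V] [Module (ZMod ℓ) V] {ρ : Representation (ZMod ℓ) G V}
    (r : Representation.Equiv (sectionRep (latticeSection ℓ (p := χ.toMonoidHom) hχ hc 0)) ρ) :
    ∃ f : Representation.IntertwiningMap (charRep ℓ ψ hψ) ρ, Function.Surjective f ∧
      ∀ (x : ψ.toMonoidHom.ker) (hx : θ x ∈ kerPow χ.toMonoidHom (ℓ ^ 0)),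
        r (SectionModule.mk _ ⟨θ x, hx⟩) = f (SectionModule.mk _ x) := by
  let h0 := latticeSection ℓ (p := χ.toMonoidHom) hχ hc 0
  have hθ' : ∀ x, χ (θ x) = ψ x := DFunLike.congr_fun hθ
  have hker : ∀ x : ψ.toMonoidHom.ker, θ x ∈ kerPow χ.toMonoidHom (ℓ ^ 0) := fun x =>
    mem_kerPow_pow_zero ℓ ((hθ' x).trans x.2)
  let Φ : ψ.toMonoidHom.ker →* Multiplicative V := MonoidHom.mk'
    (fun x => Multiplicative.ofAdd (r (SectionModule.mk h0 ⟨θ x, hker x⟩))) fun x y => by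
      rw [← ofAdd_add, ← map_add, ← SectionModule.mk_mul]
      refine congrArg (fun z => Multiplicative.ofAdd (r (SectionModule.mk h0 z))) (Subtype.ext ?_)
      exact map_mul θ (x : E) y
  -- Powers go to `ℓ L`, commutators to `1`, and `ℓ L` is closed; so the map to `L / ℓ L` descends
  -- to the characteristic module.
  have hfr : frattiniSubgroup ℓ ψ.toMonoidHom.ker ≤
      (kerPow χ.toMonoidHom (ℓ ^ (0 + 1))).comap θ.toMonoidHom := by
    refine Subgroup.topologicalClosure_minimal _ ((Subgroup.closure_le _).2 ?_)
      ((isClosed_kerPow hc _).preimage θ.continuous_toFun)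
    rintro _ (⟨x, hx, rfl⟩ | ⟨x, hx, y, hy, rfl⟩)
    · refine Subgroup.subset_closure ⟨θ x, (hθ' x).trans hx, ?_⟩
      rw [zero_add, pow_one]
      exact (map_pow θ x ℓ).symm
    · have : θ ⁅x, y⁆ = 1 := by
        rw [map_commutatorElement, commutatorElement_eq_one_iff_mul_comm]
        exact hc _ ((hθ' x).trans hx) _ ((hθ' y).trans hy)
      change θ ⁅x, y⁆ ∈ kerPow χ.toMonoidHom (ℓ ^ (0 + 1))
      rw [this]
      exact one_mem _
  obtain ⟨f, hf⟩ := exists_intertwiningMap_of_section (charSection ℓ ψ hψ) ρ Φ (fun x hx => by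
      refine congrArg Multiplicative.ofAdd ((congrArg r ?_).trans (map_zero r))
      exact (SectionModule.mk_eq_zero_iff h0 _).2 (hfr hx)) (fun a x => by
      change r _ = ρ (ψ a) (r _)
      have h1 := sectionRep_mk h0 (θ a) ⟨θ x, hker x⟩
      have h2 : χ.toMonoidHom (θ a) = ψ a := hθ' a
      rw [h2] at h1
      refine Eq.trans ?_ (LinearMap.congr_fun (r.isIntertwining' (ψ a))
        (SectionModule.mk h0 ⟨θ x, hker x⟩))
      refine Eq.trans ?_ (congrArg r h1.symm)
      refine congrArg (fun z => r (SectionModule.mk h0 z)) (Subtype.ext ?_)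
      simp)
  refine ⟨f, fun v => ?_, fun x hx => (hf x).symm⟩
  obtain ⟨z, hz⟩ := SectionModule.exists_mk h0 (r.symm v)
  -- Any preimage of an element of `L` under `θ` lies in `ker ψ`, so `θ` maps kernel onto kernel.
  obtain ⟨x, hx⟩ := hsurj z
  have hxk : ψ x = 1 := by
    rw [← hθ', hx]
    exact kerPow_le _ _ z.2
  refine ⟨SectionModule.mk _ ⟨x, hxk⟩, (hf ⟨x, hxk⟩).trans ?_⟩
  have : (⟨θ x, hker ⟨x, hxk⟩⟩ : kerPow χ.toMonoidHom (ℓ ^ 0)) = z := Subtype.ext hx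
  change r (SectionModule.mk h0 ⟨θ x, hker ⟨x, hxk⟩⟩) = v
  rw [this, hz]
  exact r.apply_symm_apply v

end Factorization

end LFrattini

/-! ### Assembly of the theorem -/

open LFrattini in
theorem mainTheorem5 (ℓ : ℕ) [Fact ℓ.Prime] {G : Type u} [Group G] [Finite G]
    [TopologicalSpace G] [DiscreteTopology G]
    (N : Sylow ℓ G) [(N : Subgroup G).Normal] (H : Subgroup G)
    (hNH : (N : Subgroup G).IsComplement' H) (t : ℕ) (ht : Group.rank N = t) :
    -- `G` has a universal `ℓ`-Frattini cover
    (∃ (E : ProfiniteGrp.{u}) (ψ : E →ₜ* G), IsUniversalLFrattiniCover ℓ ψ) ∧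
    -- the map `π : G → (ℤ/ℓ)^t ⋊ H`, the cover `μ = redMap hφ`, and the module `M' = (ℤ/ℓ)^t`
    ∃ (φ₁ : H →* MulAut (ZPow ℓ t)) (π : G →* ZPow ℓ t ⋊[φ₁] H)
      (φ₂ : H →* MulAut (ZPow (ℓ ^ 2) t))
      (hφ : ∀ g v, redHom ℓ t (φ₂ g v) = φ₁ g (redHom ℓ t v))
      (M' : Representation (ZMod ℓ) G (Fin t → ZMod ℓ)),
      IsFrattiniQuotientMap (N : Subgroup G) H π ∧
      IsFrattiniCover (redMap hφ) ∧
      -- `ker μ = M'` as a `ℤ/ℓ[G]`-module, `G` acting through `π`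
      Nonempty (Representation.Equiv
        ((sectionRep (redSection hφ)).comp π : Representation (ZMod ℓ) G _) M') ∧
      ∀ (E : ProfiniteGrp.{u}) (ψ : E →ₜ* G) (hψ : IsUniversalLFrattiniCover ℓ ψ),
        -- `μ' = π ∘ ψ` extends to a continuous surjection onto `(ℤ/ℓ²)^t ⋊ H`
        (∃ θ : E →* ZPow (ℓ ^ 2) t ⋊[φ₂] H, IsOpen (θ.ker : Set E) ∧ Function.Surjective θ ∧
          (redMap hφ).comp θ = π.comp ψ.toMonoidHom) ∧
        -- `M'` is a quotient of the characteristic module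
        ∃ f : Representation.IntertwiningMap
            (charRep ℓ ψ hψ.isLFrattiniCover.surjective) M', Function.Surjective f ∧
        -- a lattice quotient `L → G⋆ → G` of the abelianized cover, with `L = ℤ_ℓ^t`
        ∃ (Gs : ProfiniteGrp.{u}) (ψs : Gs →ₜ* G) (hs : IsLFrattiniCover ℓ ψs)
          (hc : ∀ x ∈ ψs.toMonoidHom.ker, ∀ y ∈ ψs.toMonoidHom.ker, x * y = y * x)
          (ν : AbCover ψ →ₜ* Gs) (hν : ∀ x : E, ψs (ν (QuotientGroup.mk x)) = ψ x),
          Function.Surjective ν ∧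
          Nonempty (Multiplicative (Fin t → ℤ_[ℓ]) ≃ₜ* ψs.toMonoidHom.ker) ∧
          -- `ℓ^k L / ℓ^(k+1) L = M'` for all `k`
          (∀ k : ℕ, Nonempty (Representation.Equiv
            (sectionRep (latticeSection ℓ hs.surjective hc k)) M')) ∧
          -- the map on `L / ℓ L` induced by `ν` is the quotient map `f`
          ∃ r : Representation.Equiv (sectionRep (latticeSection ℓ hs.surjective hc 0)) M',
            ∀ x : ψ.toMonoidHom.ker,
              r (SectionModule.mk _ ⟨ν (QuotientGroup.mk (x : E)),
                mem_kerPow_pow_zero ℓ (MonoidHom.mem_ker.2 ((hν x).trans x.2))⟩) =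
              f (SectionModule.mk _ x) := by
  refine ⟨exists_isUniversalLFrattiniCover ℓ, ?_⟩
  obtain ⟨s, hker, hs⟩ := exists_complement_projection hNH
  have hssurj : Function.Surjective s := fun h => ⟨h, hs h⟩
  obtain ⟨q, M, hq, hqker, hM⟩ := exists_frattini_coordinates N hker hs ht
  have hcop : (Nat.card H).Coprime ℓ := by
    rw [← hNH.symm.index_eq_card]
    exact ((Nat.Prime.coprime_iff_not_dvd Fact.out).2 N.not_dvd_index).symm
  obtain ⟨A, hA⟩ := exists_padic_lift hcop M
  obtain ⟨π, hπ, hπs, hπq⟩ := exists_isFrattiniQuotientMap hker hs hq hqker hM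
  obtain ⟨Gs, ψs, c, hcov, hlat, hred⟩ := exists_isLatticeCover hA π hπs
  obtain ⟨m, hm⟩ := IsPGroup.iff_card.1 N.isPGroup'
  -- `ℓ^m = |N|` kills `N = ker s`, and surjectivity mod `ℓ` comes from lifting elements of `N` to
  -- `Gs`.
  have hL : ∀ v, ℓ ^ m • v ∈ hlat.lattice := hlat.pow_nsmul_mem_lattice
    (fun g hg => by
      have hgN : g ∈ (N : Subgroup G) := by rwa [← hker]
      have : (⟨g, hgN⟩ : (N : Subgroup G)) ^ ℓ ^ m = 1 := by
        rw [← hm]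
        exact pow_card_eq_one'
      exact congrArg Subtype.val this)
    (fun v => by
      obtain ⟨n, hn⟩ := hq (Multiplicative.ofAdd v)
      obtain ⟨x, hx⟩ := hcov.surjective (n : G)
      refine ⟨x, ?_, ?_⟩
      · rw [hx]
        exact hker.ge n.2
      · have := hred x
        rw [hx, hπq, hn] at this
        exact this)
  have hequiv := hlat.exists_latticeSection_equiv hcop hA hssurj hcov.surjective hL
  obtain ⟨r⟩ := hequiv 0
  have hfr := isFrattiniCover_redMap (redHom_matAut hA)
  refine ⟨matAut M, π, matAut (redSq A), redHom_matAut hA, (matRep M).comp s, hπ, hfr, ?_,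
    fun E ψ hψ => ?_⟩
  · obtain ⟨e⟩ := exists_redSection_equiv hA
    refine ⟨Representation.Equiv.mk e.toLinearEquiv fun g => ?_⟩
    have := e.isIntertwining' (π g)
    refine this.trans ?_
    change matRep M (π g).right ∘ₗ _ = matRep M (s g) ∘ₗ _
    rw [hπs]
  · obtain ⟨θ, hθ⟩ := hψ.exists_factor Gs ψs hcov
    have hθ' : ∀ x, ψs (θ x) = ψ x := DFunLike.congr_fun hθ
    have hψsurj := hψ.isLFrattiniCover.surjective
    have hθsurj := hcov.surjective_of_comp hψsurj hθ
    refine ⟨?_, ?_⟩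
    -- The coordinate of `θ` in `ℤ_ℓ^t ⋊ H`, taken mod `ℓ²`; the crossed relation for `c` makes it a
    -- homomorphism.
    · let τ : E →* ZPow (ℓ ^ 2) t ⋊[matAut (redSq A)] H := MonoidHom.mk'
        (fun x => ⟨Multiplicative.ofAdd (PadicInt.toZModPow 2 ∘ c (θ x)), s (ψ x)⟩) fun x y => by
          ext1
          · refine congrArg Multiplicative.ofAdd ?_
            change _ = PadicInt.toZModPow 2 ∘ c (θ x) +
              (redSq A (s (ψ x))).mulVec (PadicInt.toZModPow 2 ∘ c (θ y))
            rw [redSq_mulVec, map_mul, hlat.crossed, hθ']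
            funext i
            simp
          · simp
      have hτ : (redMap (redHom_matAut hA)).comp τ = π.comp ψ.toMonoidHom := by
        ext1 x
        ext1
        · refine (redHom_apply (c (θ x))).trans ?_
          rw [hred, hθ']
          rfl
        · exact (hπs (ψ x)).symm
      refine ⟨τ, ?_, ?_, hτ⟩
      · have : (τ.ker : Set E) = ψ ⁻¹' {g | s g = 1} ∩
            ⋂ i, (fun x => PadicInt.toZModPow 2 (c (θ x) i)) ⁻¹' {0} := by
          ext x
          refine ⟨fun h => ?_, fun h => ?_⟩
          · have h1 : τ x = 1 := h
            have h2 : PadicInt.toZModPow 2 ∘ c (θ x) = 0 :=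
              congrArg (fun z => Multiplicative.toAdd z.left) h1
            exact ⟨congrArg SemidirectProduct.right h1, Set.mem_iInter.2 fun i => congrFun h2 i⟩
          change τ x = 1
          ext1
          · exact congrArg Multiplicative.ofAdd (funext fun i => Set.mem_iInter.1 h.2 i)
          · exact h.1
        rw [this]
        refine ((isOpen_discrete _).preimage ψ.continuous_toFun).inter
          (isOpen_iInter_of_finite fun i => ?_)
        exact ((isLocallyConstant_toZModPow 2).comp_continuous ((continuous_apply i).comp
          (hlat.continuous_coord.comp θ.continuous_toFun))).isOpen_fiber 0
      -- The range of `τ` maps onto the target of `μ`, and `μ` is a Frattini cover.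
      · refine MonoidHom.range_eq_top.1 (hfr.eq_top τ.range ?_)
        rw [MonoidHom.range_eq_map, Subgroup.map_map, hτ, ← MonoidHom.range_eq_map]
        exact MonoidHom.range_eq_top.2 (hπ.surjective.comp hψsurj)
    -- `f` is defined through `L / ℓ L` and the chosen isomorphism `r`, so its compatibility with
    -- `ν` is built in.
    · obtain ⟨f, hf, hfr⟩ := exists_charRep_intertwiningMap hψsurj hcov.surjective
        hlat.mul_comm_of_ker hθ hθsurj r
      obtain ⟨ν, hν⟩ := exists_abCover_factor hlat.mul_comm_of_ker hθ
      refine ⟨f, hf, Gs, ψs, hcov, hlat.mul_comm_of_ker, ν, fun x => by rw [hν, hθ'], fun y => ?_,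
        hlat.nonempty_continuousMulEquiv hL, hequiv, r, fun x => ?_⟩
      · obtain ⟨x, rfl⟩ := hθsurj y
        exact ⟨QuotientGroup.mk x, hν x⟩
      · rw [← hfr x (mem_kerPow_pow_zero ℓ ((hθ' x).trans x.2))]
        refine congrArg (fun z => r (SectionModule.mk _ z)) (Subtype.ext (hν x))
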